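/- **Theorem (Bożejko–Fendler).** Let $G$ be a locally compact (Hausdorff) group with a left Haar measure, let $\lambda$ be its left regular representation on $L^2(G)$, $(\lambda(x)f)(y)=f(x^{-1}y)$, and let $\mathfrak M(G)=\lambda(G)''$ be the group von Neumann algebra. The Fourier algebra $A(G)$ is the predual of $\mathfrak M(G)$, realised as the space of the functions $x\mapsto\omega(\lambda(x))$ on $G$, where $\omega$ runs through the $\sigma$-weakly continuous linear functionals on $\mathfrak M(G)$. A continuous function $\phi\colon G\to\mathbb C$ belongs to $M_0A(G)$ if $\phi\psi\in A(G)$ for every $\psi\in A(G)$ and the transposed operator $m_\phi^*\colon\mathfrak M(G)\to\mathfrak M(G)$ of $m_\phi\colon A(G)\to A(G)$, $m_\phi\psi=\phi\psi$, is completely bounded; then $\|\phi\|_{M_0A(G)}$ is the completely bounded norm of $m_\phi^*$. For $a\in M_n(\mathbb C)$ let $\|a\|_S=\sup\{\|a*b\| : b\in M_n(\mathbb C),\ \|b\|\le 1\}$, where $a*b=(a_{ij}b_{ij})$ and $\|\cdot\|$ is the operator norm on $\mathbb C^n$ with its Euclidean norm. A family $(f_i)_{i\in I}$ of complex functions on $G$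 is called locally countable if every point of $G$ has a neighbourhood on which all but countably many of the $f_i$ vanish identically. Inner products are linear in the first variable. Let $\phi\colon G\to\mathbb C$ be continuous and let $k\ge 0$. Then the following conditions are equivalent. 1. $\phi\in M_0A(G)$ and $\|\phi\|_{M_0A(G)}\le k$. 2. For every finite set $\{x_1,\dots,x_n\}$ of (distinct) elements of $G$, $\bigl\|\bigl(\phi(x_j^{-1}x_i)\bigr)_{i,j=1}^n\bigr\|_S\le k$. 3. There exist a complex Hilbert space $H$ and two bounded maps $\xi,\eta\colon G\to H$ such that $\phi(y^{-1}x)=\langle\xi(x),\eta(y)\rangle$ for all $x,y\in G$ and $\bigl(\sup_{x\in G}\|\xi(x)\|\bigr)\bigl(\sup_{y\in G}\|\eta(y)\|\bigr)\le k$. 4. There exist a complex Hilbert space $H$ and two bounded maps $\xi,\eta\colon G\to H$ as in (3) with the additional property that, for every orthonormal basis $(e_i)_{i\in I}$ of $H$, the coordinate functions $\xi_i=\langle\xi(\cdot),e_i\rangle$ and $\eta_i=\langle\eta(\cdot),e_i\rangle$ are continuous and the families $(\xi_i)_{i\in I}$ and $(\eta_i)_{i\in I}$ are locally countable. -/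

import Mathlib

universe u v

open MeasureTheory Topology
open scoped ENNReal InnerProductSpace

namespace HerzSchur

noncomputable section

/-! ### Schur multipliers of matrices -/

/-- The Schur multiplier norm of a complex matrix `a`: the supremum of the operator norms
`‖a * b‖` of the entrywise products of `a` with the matrices `b` of operator norm `≤ 1`, where
matrices act on the Euclidean space `ℂⁿ`. -/
def schurNorm {n : ℕ} (a : Matrix (Fin n) (Fin n) ℂ) : ℝ≥0∞ :=
  ⨆ (b : Matrix (Fin n) (Fin n) ℂ) (_ : ‖Matrix.toEuclideanCLM (𝕜 := ℂ) b‖ ≤ 1),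
    ‖Matrix.toEuclideanCLM (𝕜 := ℂ) (a.hadamard b)‖ₑ

/-! ### Matrices over operator algebras and completely bounded maps -/

section Operators

variable {H : Type*} [NormedAddCommGroup H] [InnerProductSpace ℂ H]

/-- The operator on the Hilbert space `Hⁿ = H ⊕ ⋯ ⊕ H` given by an `n × n` matrix of bounded
operators on `H`. -/
def matrixOperator {n : ℕ} (a : Matrix (Fin n) (Fin n) (H →L[ℂ] H)) :
    PiLp 2 (fun _ : Fin n => H) →L[ℂ] PiLp 2 (fun _ : Fin n => H) :=
  ((PiLp.continuousLinearEquiv 2 ℂ (fun _ : Fin n => H)).symm :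
      (Fin n → H) →L[ℂ] PiLp 2 (fun _ : Fin n => H)) ∘L
    ContinuousLinearMap.pi
      (fun i => ∑ j, a i j ∘L PiLp.proj (𝕜 := ℂ) 2 (fun _ : Fin n => H) j)

theorem matrixOperator_apply {n : ℕ} (a : Matrix (Fin n) (Fin n) (H →L[ℂ] H))
    (v : PiLp 2 (fun _ : Fin n => H)) (i : Fin n) :
    matrixOperator a v i = ∑ j, a i j (v j) := by
  simp [matrixOperator]

variable [CompleteSpace H]

/-- The completely bounded norm of a linear map `Φ : M → M` on a von Neumann algebra `M` of
operators on `H`: the supremum over `n` of the norms of the maps `[a i j] ↦ [Φ (a i j)]` on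
`M_n(M)`, where `M_n(M)` carries the operator norm on `Hⁿ`. It is `∞` if `Φ` is not completely
bounded. -/
def cbNorm (M : VonNeumannAlgebra H) (Φ : M.toStarSubalgebra →ₗ[ℂ] M.toStarSubalgebra) : ℝ≥0∞ :=
  ⨆ (n : ℕ) (a : Matrix (Fin n) (Fin n) M.toStarSubalgebra)
    (_ : ‖matrixOperator (a.map fun T => (T : H →L[ℂ] H))‖ ≤ 1),
    ‖matrixOperator (a.map fun T => (Φ T : H →L[ℂ] H))‖ₑ

/-- A linear functional `ω` on a von Neumann algebra `M` of operators on `H` belongs to the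
predual `M_*`, i.e. it is `σ`-weakly continuous: `ω(T) = ∑ₙ ⟨T fₙ, gₙ⟩` with square-summable
sequences `(fₙ)` and `(gₙ)` in `H`. -/
def InPredual (M : VonNeumannAlgebra H) (ω : M.toStarSubalgebra →ₗ[ℂ] ℂ) : Prop :=
  ∃ f g : ℕ → H, (Summable fun n => ‖f n‖ ^ 2) ∧ (Summable fun n => ‖g n‖ ^ 2) ∧
    ∀ T : M.toStarSubalgebra, HasSum (fun n => ⟪g n, (T : H →L[ℂ] H) (f n)⟫_ℂ) (ω T)

/-- The von Neumann algebra generated by a set `S` of bounded operators: the double commutant of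
`S ∪ S*`. -/
def generatedVonNeumannAlgebra (S : Set (H →L[ℂ] H)) : VonNeumannAlgebra H where
  carrier := Set.centralizer (Set.centralizer (S ∪ star S))
  mul_mem' := Set.mul_mem_centralizer
  add_mem' := Set.add_mem_centralizer
  algebraMap_mem' r := fun _ _ => (Algebra.commutes r _).symm
  star_mem' := Set.star_mem_centralizer' fun _ => Set.star_mem_centralizer
  centralizer_centralizer' := by
    rw [Set.centralizer_centralizer_centralizer]

theorem mem_generatedVonNeumannAlgebra {S : Set (H →L[ℂ] H)} {T : H →L[ℂ] H} (hT : T ∈ S) :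
    T ∈ (generatedVonNeumannAlgebra S).toStarSubalgebra :=
  Set.subset_centralizer_centralizer (Set.mem_union_left _ hT)

end Operators

/-! ### The regular representation, the group von Neumann algebra and the Fourier algebra -/

section Group

variable {G : Type*} [Group G] [TopologicalSpace G] [IsTopologicalGroup G]
  [MeasurableSpace G] [BorelSpace G] (μ : Measure G) [μ.IsHaarMeasure]

/-- The left regular representation on `L²(G)`: `(λ(x) f)(y) = f(x⁻¹ y)`. -/
def leftRegular (x : G) : Lp ℂ 2 μ →L[ℂ] Lp ℂ 2 μ :=
  (Lp.compMeasurePreservingₗᵢ ℂ (fun y : G => x⁻¹ * y)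
    (measurePreserving_mul_left μ x⁻¹)).toContinuousLinearMap

/-- The group von Neumann algebra `𝔐(G)`, generated by the left regular representation. -/
def groupVN : VonNeumannAlgebra (Lp ℂ 2 μ) :=
  generatedVonNeumannAlgebra (Set.range (leftRegular μ))

/-- `λ(x)` as an element of `𝔐(G)`. -/
def leftRegularVN (x : G) : (groupVN μ).toStarSubalgebra :=
  ⟨leftRegular μ x, mem_generatedVonNeumannAlgebra ⟨x, rfl⟩⟩

/-- The function `ψ` on `G` is the element of the Fourier algebra that corresponds to the
functional `ω` in the predual of `𝔐(G)`: `ψ(x) = ω(λ(x))`. -/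
def Represents (ω : (groupVN μ).toStarSubalgebra →ₗ[ℂ] ℂ) (ψ : G → ℂ) : Prop :=
  InPredual (groupVN μ) ω ∧ ∀ x, ψ x = ω (leftRegularVN μ x)

/-- The Fourier algebra `A(G)`: the predual of `𝔐(G)`, realised as the space of the functions
`x ↦ ω(λ(x)) = ∑ₙ ⟨λ(x) fₙ, gₙ⟩` on `G`. -/
def fourierAlgebra : Set (G → ℂ) :=
  {ψ | ∃ ω, Represents μ ω ψ}

/-- `φ` is a multiplier of the Fourier algebra: it is continuous and `φ ψ ∈ A(G)` for every
`ψ ∈ A(G)`. -/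
def IsMultiplier (φ : G → ℂ) : Prop :=
  Continuous φ ∧ ∀ ψ ∈ fourierAlgebra μ, φ * ψ ∈ fourierAlgebra μ

/-- `Φ : 𝔐(G) → 𝔐(G)` is the transpose `m_φ^*` of the multiplication operator
`m_φ : A(G) → A(G)`, `m_φ ψ = φ ψ`, with respect to the duality between `A(G)` and `𝔐(G)`:
`⟨Φ T, ψ⟩ = ⟨T, φ ψ⟩` for all `T ∈ 𝔐(G)` and `ψ ∈ A(G)`. -/
def IsTranspose (φ : G → ℂ)
    (Φ : (groupVN μ).toStarSubalgebra →ₗ[ℂ] (groupVN μ).toStarSubalgebra) : Prop :=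
  ∀ (ψ : G → ℂ) (ω ω' : (groupVN μ).toStarSubalgebra →ₗ[ℂ] ℂ),
    Represents μ ω ψ → Represents μ ω' (φ * ψ) → ∀ T, ω (Φ T) = ω' T

/-- `φ ∈ M₀A(G)`: `φ` is a completely bounded multiplier of `A(G)`, i.e. a multiplier whose
transposed operator on `𝔐(G)` is completely bounded. -/
def IsCBMultiplier (φ : G → ℂ) : Prop :=
  IsMultiplier μ φ ∧ ∃ Φ, IsTranspose μ φ Φ ∧ cbNorm (groupVN μ) Φ < ∞

/-- The norm `‖φ‖_{M₀A(G)}` of a completely bounded multiplier: the completely bounded norm of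
the transposed operator of `φ` (for a multiplier `φ` the transpose is
unique, so that the infimum has just one term). -/
def cbMultiplierNorm (φ : G → ℂ) : ℝ≥0∞ :=
  ⨅ (Φ) (_ : IsTranspose μ φ Φ), cbNorm (groupVN μ) Φ

end Group

/-! ### Representing functions through maps into Hilbert spaces -/

section Coefficients

variable {G : Type*} [Group G] {H : Type*} [NormedAddCommGroup H] [InnerProductSpace ℂ H]

/-- `ξ, η : G → H` are bounded maps with `φ(y⁻¹ x) = ⟨ξ(x), η(y)⟩` for all `x, y` and
`(sup ‖ξ(x)‖) (sup ‖η(y)‖) ≤ k`. Mathlib's inner product is linear in the second variable. -/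
def IsGilbertPair (φ : G → ℂ) (k : ℝ) (ξ η : G → H) : Prop :=
  BddAbove (Set.range fun x => ‖ξ x‖) ∧ BddAbove (Set.range fun y => ‖η y‖) ∧
    (∀ x y : G, φ (y⁻¹ * x) = ⟪η y, ξ x⟫_ℂ) ∧
    (⨆ x, ‖ξ x‖) * (⨆ y, ‖η y‖) ≤ k

/-- A family of complex functions on a space is locally countable if every point has a
neighbourhood on which all but countably many members of the family vanish identically. -/
def LocallyCountable {X : Type*} [TopologicalSpace X] {ι : Type*} (f : ι → X → ℂ) : Prop :=
  ∀ x, ∃ U ∈ 𝓝 x, {i | ∃ y ∈ U, f i y ≠ 0}.Countable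

/-- The coordinate functions `x ↦ ⟨ξ(x), eᵢ⟩` of a map `ξ` into a Hilbert space with respect to an
orthonormal basis are continuous, and they form a locally countable family. -/
def HasGoodCoordinates {X : Type*} [TopologicalSpace X] {ι : Type*}
    (e : HilbertBasis ι ℂ H) (ξ : X → H) : Prop :=
  (∀ i, Continuous fun x => ⟪e i, ξ x⟫_ℂ) ∧ LocallyCountable fun i x => ⟪e i, ξ x⟫_ℂ

end Coefficients

end

end HerzSchur

namespace HerzSchur

open ComplexConjugate

/-! ### Kernels that are Schur multipliers factor through a Hilbert space -/

section SchurKernels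

/-! 2 ⇒ 3 is Grothendieck's description of Schur multipliers. One seeks a positive definite kernel
on two copies of `G` with diagonal entries `k` and off-diagonal block φ(x⁻¹y); its Gram vectors are
the two maps. Such a kernel is a functional that is nonnegative on the positive semidefinite
matrices and has prescribed values on the matrices whose two diagonal blocks are diagonal. The
prescribed part is nonnegative by the Schur bound: a positive block matrix with diagonal blocks D, E
has off-diagonal block √D b √E with a contraction b. The extension theorem of M. Riesz supplies the
missing values (`IsSchurBounded.exists_inner`).

3 ⇒ 4: after compression to a space in which both maps are total (`IsGilbertPair.exists_total`),
continuity of φ becomes weak continuity of ξ and η. Bessel's inequality, integrated over an open set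
of finite measure, gives local countability (`locallyCountable_inner`).

4 ⇒ 1: let mᵢ, nᵢ be the coordinates of ξ and η at y⁻¹, acting on L² by multiplication. The map T ↦
∑ nᵢ* T mᵢ = W*(T ⊗ 1)V sends λ(x) to φ(x)λ(x) (`compression_leftRegular`); local countability
justifies exchanging sum and integral. The map is normal with completely bounded norm at most ‖W‖‖V‖
≤ k, so by the bicommutant theorem it preserves 𝔐(G) and is the transpose of multiplication by φ.

1 ⇒ 2: the transpose satisfies Φ(λ(x)) = φ(x)λ(x), and the matrices [cᵢⱼ λ(xᵢ⁻¹xⱼ)] are unitarily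
equivalent to c ⊗ 1. On this copy of the scalar matrices, the amplification of Φ is a Schur
multiplication. -/

theorem le_sqrt_mul_sqrt_of_forall_pos {A B β : ℝ} (hA : 0 ≤ A) (hB : 0 ≤ B)
    (h : ∀ t : ℝ, 0 < t → 2 * β ≤ t * A + t⁻¹ * B) : β ≤ √A * √B := by
  have key : ∀ ε : ℝ, 0 < ε → 2 * β ≤ 2 * (√A * √B) + ε * (√A + √B) := by
    intro ε hε
    have ha : 0 < √A + ε := by positivity
    have hb : 0 < √B + ε := by positivity
    -- The optimal `t` is √B / √A; adding ε keeps it meaningful when `A` or `B` is zero.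
    refine (h ((√B + ε) / (√A + ε)) (by positivity)).trans ?_
    have h1 : (√B + ε) / (√A + ε) * A ≤ (√B + ε) * √A := by
      rw [div_mul_eq_mul_div, div_le_iff₀ ha]
      have := Real.mul_self_sqrt hA
      have : 0 ≤ (√B + ε) * (√A * ε) := by positivity
      nlinarith
    have h2 : ((√B + ε) / (√A + ε))⁻¹ * B ≤ (√A + ε) * √B := by
      rw [inv_div, div_mul_eq_mul_div, div_le_iff₀ hb]
      have := Real.mul_self_sqrt hB
      have : 0 ≤ (√A + ε) * (√B * ε) := by positivity
      nlinarith
    linarith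
  have hs : 0 ≤ √A + √B := by positivity
  refine le_of_forall_pos_le_add fun δ hδ => ?_
  have h1 := key (δ / (√A + √B + 1)) (by positivity)
  have h2 : δ / (√A + √B + 1) * (√A + √B) ≤ δ := by
    rw [div_mul_eq_mul_div, div_le_iff₀ (by positivity)]
    nlinarith
  linarith

variable {X : Type*}

/-- Turning `u` by a phase makes the bilinear term β equal to -‖β‖. Rescaling `u` and `v` by √t and
1/√t then gives 2‖β‖ ≤ tA + B/t, to be optimised over t. -/
theorem norm_bilin_le_of_nonneg (S : Finset X) (b : X → X → ℂ)
    (h : ∀ u v : X → ℂ, 0 ≤ ∑ x ∈ S, ‖u x‖ ^ 2 + ∑ x ∈ S, ‖v x‖ ^ 2 +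
      2 * (∑ x ∈ S, ∑ y ∈ S, b x y * u x * v y).re) (u v : X → ℂ) :
    ‖∑ x ∈ S, ∑ y ∈ S, b x y * u x * v y‖ ≤
      √(∑ x ∈ S, ‖u x‖ ^ 2) * √(∑ x ∈ S, ‖v x‖ ^ 2) := by
  refine le_sqrt_mul_sqrt_of_forall_pos (by positivity) (by positivity) fun t ht => ?_
  set β := ∑ x ∈ S, ∑ y ∈ S, b x y * u x * v y with hβ
  obtain ⟨z, hz, hzβ⟩ : ∃ z : ℂ, ‖z‖ = 1 ∧ z * β = -(‖β‖ : ℂ) := by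
    by_cases h0 : β = 0
    · exact ⟨1, by simp, by simp [h0]⟩
    · have h0' : (‖β‖ : ℂ) ≠ 0 := by simpa using h0
      refine ⟨-(conj β) / ‖β‖, by simp [h0], ?_⟩
      rw [div_mul_eq_mul_div, div_eq_iff h0', neg_mul, Complex.conj_mul']
      ring
  have h1 := h (fun x => (√t : ℂ) * z * u x) (fun y => ((√t)⁻¹ : ℂ) * v y)
  have hst : (√t : ℂ) ≠ 0 := by
    rw [Ne, Complex.ofReal_eq_zero, Real.sqrt_eq_zero']; linarith
  have h2 : ∑ x ∈ S, ∑ y ∈ S, b x y * ((√t : ℂ) * z * u x) * (((√t)⁻¹ : ℂ) * v y) = z * β := by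
    simp only [hβ, Finset.mul_sum]
    refine Finset.sum_congr rfl fun x _ => Finset.sum_congr rfl fun y _ => ?_
    field_simp
  rw [h2, hzβ] at h1
  simp only [norm_mul, norm_inv, hz, mul_one, Complex.norm_real, Real.norm_eq_abs,
    abs_of_nonneg (Real.sqrt_nonneg t), mul_pow, inv_pow, Real.sq_sqrt ht.le, ← Finset.mul_sum,
    Complex.neg_re, Complex.ofReal_re] at h1
  linarith

/-- The condition that the entrywise product with the kernel `a` multiplies the operator norm of
finite matrices by at most `k`. -/
def IsSchurBounded (a : X → X → ℂ) (k : ℝ) : Prop :=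
  ∀ (S : Finset X) (b : X → X → ℂ),
    (∀ u v : X → ℂ, ‖∑ x ∈ S, ∑ y ∈ S, b x y * u x * v y‖ ≤
      √(∑ x ∈ S, ‖u x‖ ^ 2) * √(∑ x ∈ S, ‖v x‖ ^ 2)) →
    ∀ u v : X → ℂ, ‖∑ x ∈ S, ∑ y ∈ S, a x y * b x y * u x * v y‖ ≤
      k * (√(∑ x ∈ S, ‖u x‖ ^ 2) * √(∑ x ∈ S, ‖v x‖ ^ 2))

/-- Positivity writes `c` as 2√d b √e with `b` of norm at most 1. The Schur bound for `b`, tested on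
the vectors √d and √e, controls the pairing of `c` with `a`, and the inequality of the means gives
the sum of the weights. -/
theorem IsSchurBounded.pairing_nonneg {a : X → X → ℂ} {k : ℝ} (hk : 0 ≤ k)
    (ha : IsSchurBounded a k) (S : Finset X) (d e : X → ℝ) (c : X → X → ℂ)
    (h : ∀ u v : X → ℂ, 0 ≤ ∑ x ∈ S, d x * ‖u x‖ ^ 2 + ∑ y ∈ S, e y * ‖v y‖ ^ 2 +
      (∑ x ∈ S, ∑ y ∈ S, c x y * conj (u x) * v y).re) :
    0 ≤ k * (∑ x ∈ S, d x + ∑ y ∈ S, e y) + (∑ x ∈ S, ∑ y ∈ S, c x y * a x y).re := by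
  classical
  have hd : ∀ x ∈ S, 0 ≤ d x := fun x hx => by
    have := h (Pi.single x 1) 0
    simpa [Pi.single_apply, apply_ite, hx] using this
  have he : ∀ x ∈ S, 0 ≤ e x := fun x hx => by
    have := h 0 (Pi.single x 1)
    simpa [Pi.single_apply, apply_ite, hx] using this
  -- The shift by ε makes the weights invertible; it is removed at the end.
  have key : ∀ ε : ℝ, 0 < ε → 0 ≤ k * (∑ x ∈ S, (d x + ε) + ∑ y ∈ S, (e y + ε)) +
      (∑ x ∈ S, ∑ y ∈ S, c x y * a x y).re := by
    intro ε hε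
    have hs : ∀ x ∈ S, 0 < √(d x + ε) := fun x hx => Real.sqrt_pos.2 (by linarith [hd x hx])
    have ht : ∀ x ∈ S, 0 < √(e x + ε) := fun x hx => Real.sqrt_pos.2 (by linarith [he x hx])
    have hsc : ∀ x ∈ S, (√(d x + ε) : ℂ) ≠ 0 := fun x hx => by exact_mod_cast (hs x hx).ne'
    have htc : ∀ x ∈ S, (√(e x + ε) : ℂ) ≠ 0 := fun x hx => by exact_mod_cast (ht x hx).ne'
    have hb := norm_bilin_le_of_nonneg S (fun x y => c x y / (2 * √(d x + ε) * √(e y + ε)))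
      (fun u v => by
        refine (h (fun x => conj (u x) / √(d x + ε)) (fun y => v y / √(e y + ε))).trans ?_
        refine add_le_add (add_le_add ?_ ?_) (le_of_eq ?_)
        · refine Finset.sum_le_sum fun x hx => ?_
          have := hd x hx
          rw [norm_div, RCLike.norm_conj, Complex.norm_real, Real.norm_eq_abs,
            abs_of_pos (hs x hx), div_pow, Real.sq_sqrt (by linarith), ← mul_div_assoc,
            div_le_iff₀ (by linarith)]
          nlinarith [sq_nonneg ‖u x‖]
        · refine Finset.sum_le_sum fun x hx => ?_
          have := he x hx
          rw [norm_div, Complex.norm_real, Real.norm_eq_abs,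
            abs_of_pos (ht x hx), div_pow, Real.sq_sqrt (by linarith), ← mul_div_assoc,
            div_le_iff₀ (by linarith)]
          nlinarith [sq_nonneg ‖v x‖]
        · rw [← Complex.re_ofReal_mul]
          congr 1
          simp only [Finset.mul_sum]
          refine Finset.sum_congr rfl fun x hx => Finset.sum_congr rfl fun y hy => ?_
          have := hsc x hx
          have := htc y hy
          simp only [map_div₀, Complex.conj_conj, Complex.conj_ofReal, Complex.ofReal_ofNat]
          field_simp)
    have h1 := ha S _ hb (fun x => √(d x + ε)) (fun y => √(e y + ε))
    have h2 : ∑ x ∈ S, ∑ y ∈ S, a x y * (c x y / (2 * √(d x + ε) * √(e y + ε))) *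
        (√(d x + ε) : ℂ) * (√(e y + ε) : ℂ) =
        ((1 / 2 : ℝ) : ℂ) * ∑ x ∈ S, ∑ y ∈ S, c x y * a x y := by
      simp only [Finset.mul_sum]
      refine Finset.sum_congr rfl fun x hx => Finset.sum_congr rfl fun y hy => ?_
      have := hsc x hx
      have := htc y hy
      push_cast
      field_simp
    rw [h2] at h1
    have h3 : ∑ x ∈ S, ‖(√(d x + ε) : ℂ)‖ ^ 2 = ∑ x ∈ S, (d x + ε) :=
      Finset.sum_congr rfl fun x hx => by
        rw [Complex.norm_real, Real.norm_eq_abs, sq_abs, Real.sq_sqrt (by linarith [hd x hx])]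
    have h4 : ∑ x ∈ S, ‖(√(e x + ε) : ℂ)‖ ^ 2 = ∑ x ∈ S, (e x + ε) :=
      Finset.sum_congr rfl fun x hx => by
        rw [Complex.norm_real, Real.norm_eq_abs, sq_abs, Real.sq_sqrt (by linarith [he x hx])]
    rw [h3, h4] at h1
    have h5 := (neg_le_of_abs_le ((Complex.abs_re_le_norm _).trans h1))
    rw [Complex.re_ofReal_mul] at h5
    have hD : 0 ≤ ∑ x ∈ S, (d x + ε) := Finset.sum_nonneg fun x hx => by linarith [hd x hx]
    have hE : 0 ≤ ∑ x ∈ S, (e x + ε) := Finset.sum_nonneg fun x hx => by linarith [he x hx]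
    have h6 : 2 * (√(∑ x ∈ S, (d x + ε)) * √(∑ x ∈ S, (e x + ε))) ≤
        ∑ x ∈ S, (d x + ε) + ∑ y ∈ S, (e y + ε) := by
      nlinarith [sq_nonneg (√(∑ x ∈ S, (d x + ε)) - √(∑ x ∈ S, (e x + ε))),
        Real.mul_self_sqrt hD, Real.mul_self_sqrt hE]
    nlinarith [mul_le_mul_of_nonneg_left h6 hk]
  by_contra hneg
  push Not at hneg
  set V := k * (∑ x ∈ S, d x + ∑ y ∈ S, e y) + (∑ x ∈ S, ∑ y ∈ S, c x y * a x y).re with hV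
  -- With this ε the correction 2kε|S| stays below -V, and the denominator is positive even if `k`
  -- or `S` is trivial.
  have h1 := key (-V / (4 * k * S.card + 1)) (by
    have : 0 < -V := by linarith
    positivity)
  simp only [Finset.sum_add_distrib, Finset.sum_const, nsmul_eq_mul] at h1
  set ε := -V / (4 * k * S.card + 1)
  have h2 : ε * (4 * k * S.card + 1) = -V := div_mul_cancel₀ _ (by positivity)
  have h3 : 0 < ε := div_pos (by linarith) (by positivity)
  nlinarith

/-- A positive definite kernel is a Gram matrix. -/
theorem exists_gram {α : Type u} (K : α → α → ℂ) (herm : ∀ x y, K y x = conj (K x y))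
    (pos : ∀ f : α →₀ ℂ, 0 ≤ (f.sum fun x z => f.sum fun y w => conj z * w * K x y).re) :
    ∃ (H : Type u) (_ : NormedAddCommGroup H) (_ : InnerProductSpace ℂ H) (_ : CompleteSpace H)
      (v : α → H), ∀ x y, ⟪v x, v y⟫_ℂ = K x y := by
  -- The space is the reproducing kernel Hilbert space of `K`, with scalars read as operators on
  -- `ℂ`; `v x` is the kernel function at `x`.
  let L : Matrix α α (ℂ →L[ℂ] ℂ) := Matrix.of fun x y => K x y • ContinuousLinearMap.id ℂ ℂ
  have hL : L.PosSemidef := by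
    have h := (RKHS.posSemidef_tfae (K := L)).out 0 2
    refine h.2 ⟨?_, fun f => ?_⟩
    · ext x y
      refine ext_inner_right ℂ fun w => ?_
      rw [Matrix.conjTranspose_apply, ContinuousLinearMap.star_eq_adjoint,
        ContinuousLinearMap.adjoint_inner_left]
      simp [L, herm x y, mul_comm]
    · refine (pos f).trans_eq (congrArg Complex.re ?_)
      refine Finsupp.sum_congr fun x _ => Finsupp.sum_congr fun y _ => ?_
      simp [L, ← herm]
      ring
  have : Fact L.PosSemidef := ⟨hL⟩
  refine ⟨RKHS.OfKernel L, inferInstance, inferInstance, inferInstance,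
    fun x => RKHS.kerFun (RKHS.OfKernel L) x 1, fun x y => ?_⟩
  rw [← RKHS.kernel_inner, RKHS.OfKernel.kernel_ofKernel]
  simp [L, herm x y]

/-- The real quadratic functional on finitely supported matrices that is given by a kernel. -/
noncomputable def matrixPairing {α : Type*} (κ : α × α → ℂ) : (α × α →₀ ℂ) →ₗ[ℝ] ℝ :=
  Complex.reLm ∘ₗ (Finsupp.linearCombination ℂ κ).restrictScalars ℝ

theorem matrixPairing_single {α : Type*} (κ : α × α → ℂ) (p : α × α) (c : ℂ) :
    matrixPairing κ (Finsupp.single p c) = (c * κ p).re := by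
  simp [matrixPairing]

/-- The cone of the finitely supported matrices with positive semidefinite real part. -/
def psdCone (α : Type*) : PointedCone ℝ (α × α →₀ ℂ) where
  carrier := {M | ∀ w : α → ℂ, 0 ≤ matrixPairing (fun p => conj (w p.1) * w p.2) M}
  add_mem' hM hN w := by simpa using add_nonneg (hM w) (hN w)
  zero_mem' w := by simp
  smul_mem' c M hM w := by
    have : matrixPairing (fun p => conj (w p.1) * w p.2) (c • M) =
      (c : ℝ) * matrixPairing (fun p => conj (w p.1) * w p.2) M := by
      rw [← smul_eq_mul, ← map_smul]; rfl
    rw [this]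
    exact mul_nonneg c.2 (hM w)

theorem mem_psdCone {α : Type*} {M : α × α →₀ ℂ} : M ∈ psdCone α ↔
    ∀ w : α → ℂ, 0 ≤ matrixPairing (fun p => conj (w p.1) * w p.2) M := Iff.rfl

/-- The matrices over `X ⊕ X` whose two diagonal blocks are diagonal. -/
def blockDiagonal (X : Type*) : Submodule ℝ ((X ⊕ X) × (X ⊕ X) →₀ ℂ) where
  carrier := {M | ∀ x y, x ≠ y → M (Sum.inl x, Sum.inl y) = 0 ∧ M (Sum.inr x, Sum.inr y) = 0}
  add_mem' hM hN x y hxy := by simp [hM x y hxy, hN x y hxy]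
  zero_mem' x y _ := by simp
  smul_mem' c M hM x y hxy := by simp [hM x y hxy]

theorem single_diag_mem_blockDiagonal (q : X ⊕ X) (r : ℂ) :
    Finsupp.single (q, q) r ∈ blockDiagonal X := by
  classical
  intro x y hxy
  constructor <;>
  · rw [Finsupp.single_apply, if_neg]
    rintro h
    rw [Prod.mk.injEq] at h
    exact hxy (by simpa using h.1.symm.trans h.2)

/-- This is the cofinality hypothesis of the Riesz extension theorem. An entry `c` at (p, q) is
dominated by `‖c‖` placed at (p, p) and (q, q), since |w_p||w_q| ≤ |w_p|² + |w_q|². -/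
theorem exists_add_mem_psdCone (M : (X ⊕ X) × (X ⊕ X) →₀ ℂ) :
    ∃ D ∈ blockDiagonal X, D + M ∈ psdCone (X ⊕ X) := by
  classical
  induction M using Finsupp.induction_linear with
  | zero => exact ⟨0, zero_mem _, by simp⟩
  | add M N hM hN =>
    obtain ⟨D, hD, hD'⟩ := hM
    obtain ⟨E, hE, hE'⟩ := hN
    refine ⟨D + E, add_mem hD hE, ?_⟩
    rw [add_add_add_comm]
    exact add_mem hD' hE'
  | single p c =>
    refine ⟨Finsupp.single (p.1, p.1) (‖c‖ : ℂ) + Finsupp.single (p.2, p.2) (‖c‖ : ℂ),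
      add_mem (single_diag_mem_blockDiagonal _ _) (single_diag_mem_blockDiagonal _ _), fun w => ?_⟩
    simp only [map_add, matrixPairing_single]
    have h1 : ∀ z : ℂ, ((‖c‖ : ℂ) * (conj z * z)).re = ‖c‖ * ‖z‖ ^ 2 := fun z => by
      rw [Complex.conj_mul', Complex.re_ofReal_mul]
      norm_cast
    have h2 := neg_le_of_abs_le (Complex.abs_re_le_norm (c * (conj (w p.1) * w p.2)))
    rw [norm_mul, norm_mul, RCLike.norm_conj] at h2
    rw [h1, h1]
    nlinarith [norm_nonneg c, mul_nonneg (norm_nonneg c) (sq_nonneg (‖w p.1‖ - ‖w p.2‖)),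
      mul_nonneg (norm_nonneg c) (sq_nonneg (‖w p.1‖)),
      mul_nonneg (norm_nonneg c) (sq_nonneg (‖w p.2‖))]

open Classical in
/-- The partially defined kernel on `X ⊕ X` with diagonal `k` and off-diagonal blocks `a`
and `a*`. -/
noncomputable def blockKernel (a : X → X → ℂ) (k : ℝ) : (X ⊕ X) × (X ⊕ X) → ℂ
  | (Sum.inl x, Sum.inl y) => if x = y then k else 0
  | (Sum.inr x, Sum.inr y) => if x = y then k else 0
  | (Sum.inl x, Sum.inr y) => a x y
  | (Sum.inr y, Sum.inl x) => conj (a x y)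

theorem exists_matrixPairing_eq (M : (X ⊕ X) × (X ⊕ X) →₀ ℂ) : ∃ S : Finset X,
    ∀ κ : (X ⊕ X) × (X ⊕ X) → ℂ, matrixPairing κ M =
      (∑ x ∈ S, ∑ y ∈ S, M (Sum.inl x, Sum.inl y) * κ (Sum.inl x, Sum.inl y)).re +
      (∑ x ∈ S, ∑ y ∈ S, M (Sum.inr x, Sum.inr y) * κ (Sum.inr x, Sum.inr y)).re +
      (∑ x ∈ S, ∑ y ∈ S, (M (Sum.inl x, Sum.inr y) * κ (Sum.inl x, Sum.inr y) +
        M (Sum.inr y, Sum.inl x) * κ (Sum.inr y, Sum.inl x))).re := by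
  classical
  let T : Finset (X ⊕ X) := M.support.image Prod.fst ∪ M.support.image Prod.snd
  let S : Finset X := T.toLeft ∪ T.toRight
  have hT : M.support ⊆ S.disjSum S ×ˢ S.disjSum S := by
    intro p hp
    have h : ∀ q ∈ T, q ∈ S.disjSum S := by
      rintro (q | q) hq
      · exact Finset.inl_mem_disjSum.2 (Finset.mem_union_left _ (Finset.mem_toLeft.2 hq))
      · exact Finset.inr_mem_disjSum.2 (Finset.mem_union_right _ (Finset.mem_toRight.2 hq))
    exact Finset.mem_product.2 ⟨h _ (Finset.mem_union_left _ (Finset.mem_image_of_mem _ hp)),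
      h _ (Finset.mem_union_right _ (Finset.mem_image_of_mem _ hp))⟩
  refine ⟨S, fun κ => ?_⟩
  have h1 : matrixPairing κ M = (Finsupp.linearCombination ℂ κ M).re := rfl
  rw [h1, Finsupp.linearCombination_apply, Finsupp.sum_of_support_subset _ hT _ (by simp),
    Finset.sum_product]
  simp only [Finset.sum_disjSum, smul_eq_mul, Finset.sum_add_distrib, Complex.add_re]
  rw [Finset.sum_comm (s := S) (t := S) (f := fun x y => M (Sum.inr y, Sum.inl x) * _)]
  ring

theorem IsSchurBounded.matrixPairing_nonneg {a : X → X → ℂ} {k : ℝ} (hk : 0 ≤ k)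
    (ha : IsSchurBounded a k) {M : (X ⊕ X) × (X ⊕ X) →₀ ℂ} (hM : M ∈ blockDiagonal X)
    (hM' : M ∈ psdCone (X ⊕ X)) : 0 ≤ matrixPairing (blockKernel a k) M := by
  classical
  obtain ⟨S, hS⟩ := exists_matrixPairing_eq M
  have hl : ∀ κ : X → X → ℂ, ∑ x ∈ S, ∑ y ∈ S, M (Sum.inl x, Sum.inl y) * κ x y =
      ∑ x ∈ S, M (Sum.inl x, Sum.inl x) * κ x x := fun κ =>
    Finset.sum_congr rfl fun x hx => Finset.sum_eq_single_of_mem x hx fun y _ hy => by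
      rw [(hM x y hy.symm).1, zero_mul]
  have hr : ∀ κ : X → X → ℂ, ∑ x ∈ S, ∑ y ∈ S, M (Sum.inr x, Sum.inr y) * κ x y =
      ∑ x ∈ S, M (Sum.inr x, Sum.inr x) * κ x x := fun κ =>
    Finset.sum_congr rfl fun x hx => Finset.sum_eq_single_of_mem x hx fun y _ hy => by
      rw [(hM x y hy.symm).2, zero_mul]
  -- Only real parts matter, so the lower left block folds into the upper right one by conjugation.
  have hre : ∀ m c : X → X → ℂ, ∀ κ κ' : X → X → ℂ, (∀ x y, κ' x y = conj (κ x y)) →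
      (∑ x ∈ S, ∑ y ∈ S, (m x y * κ x y + c x y * κ' x y)).re =
      (∑ x ∈ S, ∑ y ∈ S, (m x y + conj (c x y)) * κ x y).re := by
    intro m c κ κ' h
    simp only [Complex.re_sum, h]
    refine Finset.sum_congr rfl fun x _ => Finset.sum_congr rfl fun y _ => ?_
    simp [Complex.add_re, Complex.mul_re]
    ring
  have h := ha.pairing_nonneg hk S (fun x => (M (Sum.inl x, Sum.inl x)).re)
    (fun x => (M (Sum.inr x, Sum.inr x)).re)
    (fun x y => M (Sum.inl x, Sum.inr y) + conj (M (Sum.inr y, Sum.inl x))) (fun u v => by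
      have h1 := hM' (Sum.elim u v)
      have h2 : ∀ m z : ℂ, (m * (conj z * z)).re = m.re * ‖z‖ ^ 2 := fun m z => by
        rw [Complex.conj_mul', mul_comm, ← Complex.ofReal_pow, Complex.re_ofReal_mul, mul_comm]
      rw [hS] at h1
      simp only [Sum.elim_inl, Sum.elim_inr] at h1
      rw [hl (fun x y => conj (u x) * u y), hr (fun x y => conj (v x) * v y),
        hre (fun x y => M (Sum.inl x, Sum.inr y)) (fun x y => M (Sum.inr y, Sum.inl x))
          (fun x y => conj (u x) * v y) (fun x y => conj (v y) * u x)
          (fun x y => by simp [mul_comm])] at h1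
      simpa only [Complex.re_sum, h2, mul_assoc] using h1)
  rw [hS]
  simp only [blockKernel]
  rw [hl (fun x y => if x = y then (k : ℂ) else 0), hr (fun x y => if x = y then (k : ℂ) else 0),
    hre (fun x y => M (Sum.inl x, Sum.inr y)) (fun x y => M (Sum.inr y, Sum.inl x))
      (fun x y => a x y) (fun x y => conj (a x y)) (fun x y => rfl)]
  simpa [Complex.re_sum, mul_add, Finset.mul_sum, mul_comm] using h

/-- A kernel with bounded Schur multiplier norm is of the form `⟪p x, q y⟫` with bounded
Hilbert space valued maps `p` and `q`. -/
theorem IsSchurBounded.exists_inner {X : Type u} {a : X → X → ℂ} {k : ℝ} (hk : 0 ≤ k)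
    (ha : IsSchurBounded a k) :
    ∃ (H : Type u) (_ : NormedAddCommGroup H) (_ : InnerProductSpace ℂ H) (_ : CompleteSpace H)
      (p q : X → H), (∀ x y, ⟪p x, q y⟫_ℂ = a x y) ∧ (∀ x, ‖p x‖ = √k) ∧ ∀ x, ‖q x‖ = √k := by
  classical
  obtain ⟨g, hgf, hg⟩ := riesz_extension (psdCone (X ⊕ X))
    ⟨blockDiagonal X, (matrixPairing (blockKernel a k)).domRestrict _⟩
    (fun M hM => ha.matrixPairing_nonneg hk M.2 hM)
    (fun M => by
      obtain ⟨D, hD, h⟩ := exists_add_mem_psdCone M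
      exact ⟨⟨D, hD⟩, h⟩)
  replace hgf : ∀ M ∈ blockDiagonal X, g M = matrixPairing (blockKernel a k) M :=
    fun M hM => hgf ⟨M, hM⟩
  -- `g` is only real linear; `K` is the kernel for which `g` takes the value Re(c K p q) on an
  -- entry `c` at (p, q).
  let K : X ⊕ X → X ⊕ X → ℂ := fun p q =>
    (g (Finsupp.single (p, q) 1) : ℂ) - g (Finsupp.single (p, q) Complex.I) * Complex.I
  have hK : ∀ p q c, g (Finsupp.single (p, q) c) = (c * K p q).re := by
    intro p q c
    have h1 : Finsupp.single (p, q) c = c.re • Finsupp.single (p, q) (1 : ℂ) +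
        c.im • Finsupp.single (p, q) Complex.I := by
      rw [Finsupp.smul_single, Finsupp.smul_single, ← Finsupp.single_add]
      congr 1
      simp
    rw [h1, map_add, map_smul, map_smul]
    simp [K, Complex.mul_re]
  have hre : ∀ z w : ℂ, (∀ c : ℂ, (c * z).re = (c * w).re) → z = w := by
    intro z w h
    have h1 := h 1
    have h2 := h Complex.I
    refine Complex.ext (by simpa using h1) (by simpa using h2)
  have hKab : ∀ p q, (∀ c, Finsupp.single (p, q) c ∈ blockDiagonal X) →
      K p q = blockKernel a k (p, q) := fun p q h => hre _ _ fun c => by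
    rw [← hK, hgf _ (h c), matrixPairing_single]
  have herm : ∀ p q, K q p = conj (K p q) := by
    intro p q
    refine hre _ _ fun c => ?_
    -- The form of this matrix has zero real part, so the matrix and its negative both lie in the
    -- cone and `g` vanishes on it.
    have h1 : ∀ d : ℂ, Finsupp.single (q, p) d - Finsupp.single (p, q) (conj d) ∈
        psdCone (X ⊕ X) := by
      intro d w
      rw [map_sub, matrixPairing_single, matrixPairing_single]
      simp [Complex.mul_re]
      apply le_of_eq
      ring
    have h2 := hg _ (h1 c)
    have h3 := hg _ (h1 (-c))
    rw [map_sub, hK, hK] at h2 h3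
    have h4 : (c * conj (K p q)).re = (conj c * K p q).re := by
      simp [Complex.mul_re]
    rw [h4]
    simp only [map_neg, neg_mul, Complex.neg_re] at h3
    linarith
  have pos : ∀ f : X ⊕ X →₀ ℂ,
      0 ≤ (f.sum fun x z => f.sum fun y w => conj z * w * K x y).re := by
    intro f
    -- The rank-one matrix built from `f` has the form |∑ f(x) w(x)|², so it lies in the cone.
    have h1 : g (f.sum fun x z => f.sum fun y w => Finsupp.single (x, y) (conj z * w)) =
        (f.sum fun x z => f.sum fun y w => conj z * w * K x y).re := by
      simp only [Finsupp.sum, map_sum, hK, Complex.re_sum]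
    rw [← h1]
    refine hg _ fun w => ?_
    have h2 : matrixPairing (fun p => conj (w p.1) * w p.2)
        (f.sum fun x z => f.sum fun y w => Finsupp.single (x, y) (conj z * w)) =
        (conj (f.sum fun x z => z * w x) * (f.sum fun x z => z * w x)).re := by
      simp only [Finsupp.sum, map_sum, matrixPairing_single, Finset.sum_mul_sum, Complex.re_sum]
      refine Finset.sum_congr rfl fun x _ => Finset.sum_congr rfl fun y _ => ?_
      rw [map_mul]
      ring_nf
    rw [h2, Complex.conj_mul', ← Complex.ofReal_pow, Complex.ofReal_re]
    positivity
  obtain ⟨H, i1, i2, i3, v, hv⟩ := exists_gram K herm pos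
  have hnorm : ∀ p, K p p = k → ‖v p‖ = √k := fun p hp => by
    rw [← Real.sqrt_sq (norm_nonneg (v p))]
    congr 1
    have := inner_self_eq_norm_sq_to_K (𝕜 := ℂ) (v p)
    rw [hv, hp] at this
    refine Complex.ofReal_injective ?_
    rw [Complex.ofReal_pow]
    exact this.symm
  refine ⟨H, i1, i2, i3, fun x => v (Sum.inl x), fun x => v (Sum.inr x), fun x y => ?_,
    fun x => hnorm _ ?_, fun x => hnorm _ ?_⟩
  · rw [hv, hKab]
    · rfl
    · intro c x' y' _
      simp
  · rw [hKab]
    · simp [blockKernel]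
    · exact single_diag_mem_blockDiagonal _
  · rw [hKab]
    · simp [blockKernel]
    · exact single_diag_mem_blockDiagonal _

end SchurKernels

/-! ### From matrix norms to kernels on `G` -/

section SchurNorm

/-- Bilinear forms may replace sesquilinear ones because conjugating `u` changes no norm. For the
converse, `u` is the conjugate of the image of `v`. -/
theorem norm_toEuclideanCLM_le_iff {n : ℕ} (B : Matrix (Fin n) (Fin n) ℂ) {c : ℝ} (hc : 0 ≤ c) :
    ‖Matrix.toEuclideanCLM (𝕜 := ℂ) B‖ ≤ c ↔ ∀ u v : Fin n → ℂ,
      ‖∑ i, ∑ j, B i j * u i * v j‖ ≤ c * (√(∑ i, ‖u i‖ ^ 2) * √(∑ i, ‖v i‖ ^ 2)) := by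
  have key : ∀ u v : Fin n → ℂ, ∑ i, ∑ j, B i j * u i * v j =
      ⟪WithLp.toLp 2 (fun i => conj (u i)), Matrix.toEuclideanCLM (𝕜 := ℂ) B (WithLp.toLp 2 v)⟫_ℂ := by
    intro u v
    simp only [Matrix.toEuclideanCLM_toLp, PiLp.inner_apply, Matrix.mulVec, dotProduct,
      RCLike.inner_apply, Complex.conj_conj, Finset.sum_mul]
    exact Finset.sum_congr rfl fun i _ => Finset.sum_congr rfl fun j _ => by ring
  have hn : ∀ u : Fin n → ℂ, ‖WithLp.toLp 2 u‖ = √(∑ i, ‖u i‖ ^ 2) := fun u =>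
    EuclideanSpace.norm_eq _
  constructor
  · intro h u v
    rw [key]
    refine (norm_inner_le_norm _ _).trans ?_
    have h1 := (Matrix.toEuclideanCLM (𝕜 := ℂ) B).le_of_opNorm_le h (WithLp.toLp 2 v)
    refine (mul_le_mul_of_nonneg_left h1 (norm_nonneg _)).trans (le_of_eq ?_)
    rw [hn, hn]
    simp only [RCLike.norm_conj]
    ring
  · intro h
    refine ContinuousLinearMap.opNorm_le_bound _ hc fun v => ?_
    set w := Matrix.toEuclideanCLM (𝕜 := ℂ) B v with hw
    have h1 := h (fun i => conj (w i)) (fun i => v i)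
    rw [key] at h1
    simp only [Complex.conj_conj, RCLike.norm_conj] at h1
    rw [← EuclideanSpace.norm_eq, ← EuclideanSpace.norm_eq] at h1
    change ‖⟪w, w⟫_ℂ‖ ≤ _ at h1
    rw [inner_self_eq_norm_sq_to_K, norm_pow, RCLike.norm_ofReal, abs_norm] at h1
    rcases (norm_nonneg w).eq_or_lt with h0 | h0
    · rw [← h0]; positivity
    · nlinarith

theorem schurNorm_le_iff {n : ℕ} (a : Matrix (Fin n) (Fin n) ℂ) {k : ℝ} (hk : 0 ≤ k) :
    schurNorm a ≤ ENNReal.ofReal k ↔ ∀ b : Matrix (Fin n) (Fin n) ℂ,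
      ‖Matrix.toEuclideanCLM (𝕜 := ℂ) b‖ ≤ 1 →
        ‖Matrix.toEuclideanCLM (𝕜 := ℂ) (a.hadamard b)‖ ≤ k := by
  simp only [schurNorm, iSup_le_iff]
  refine forall_congr' fun b => imp_congr_right fun _ => ?_
  rw [← ofReal_norm, ENNReal.ofReal_le_ofReal_iff hk]

theorem isSchurBounded_of_schurNorm_le {X : Type*} {a : X → X → ℂ} {k : ℝ} (hk : 0 ≤ k)
    (h : ∀ (n : ℕ) (x : Fin n → X), Function.Injective x →
      schurNorm (Matrix.of fun i j => a (x j) (x i)) ≤ ENNReal.ofReal k) :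
    IsSchurBounded a k := by
  intro S b hb u v
  let x : Fin S.card → X := fun i => (S.equivFin.symm i : X)
  have hx : Function.Injective x := Subtype.val_injective.comp S.equivFin.symm.injective
  have hsum : ∀ {M : Type} [AddCommMonoid M] (f : X → M), ∑ y ∈ S, f y = ∑ i, f (x i) := by
    intro M _ f
    rw [← Finset.sum_coe_sort S f, ← Equiv.sum_comp S.equivFin.symm]
  have hB : ‖Matrix.toEuclideanCLM (𝕜 := ℂ) (Matrix.of fun i j => b (x j) (x i))‖ ≤ 1 := by
    rw [norm_toEuclideanCLM_le_iff _ zero_le_one]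
    intro w z
    have h1 := hb (Function.extend x z 0) (Function.extend x w 0)
    simp only [hsum, hx.extend_apply] at h1
    -- The (i, j) entry is taken at (x j, x i), so the two vectors exchange roles.
    rw [one_mul, mul_comm, Finset.sum_comm]
    simpa only [Matrix.of_apply, mul_right_comm] using h1
  have h1 := (norm_toEuclideanCLM_le_iff _ hk).1
    ((schurNorm_le_iff _ hk).1 (h _ x hx) _ hB) (fun i => v (x i)) (fun i => u (x i))
  simp only [hsum]
  rw [Finset.sum_comm, mul_comm (√_)] at h1
  simpa only [Matrix.of_apply, Matrix.hadamard_apply, mul_right_comm] using h1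

variable {G : Type u} [Group G]

theorem exists_isGilbertPair_of_schurNorm_le {φ : G → ℂ} {k : ℝ} (hk : 0 ≤ k)
    (h : ∀ (n : ℕ) (x : Fin n → G), Function.Injective x →
        schurNorm (Matrix.of fun i j => φ ((x j)⁻¹ * x i)) ≤ ENNReal.ofReal k) :
    ∃ (H : Type (max u v)) (_ : NormedAddCommGroup H) (_ : InnerProductSpace ℂ H)
        (_ : CompleteSpace H) (ξ η : G → H), IsGilbertPair φ k ξ η := by
  -- The lift only moves the Hilbert space into the required universe.
  have h1 : IsSchurBounded (fun x y : ULift.{v} G => φ (x.down⁻¹ * y.down)) k :=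
    isSchurBounded_of_schurNorm_le hk fun n x hx =>
      h n (fun i => (x i).down) (ULift.down_injective.comp hx)
  obtain ⟨H, i1, i2, i3, p, q, hpq, hp, hq⟩ := h1.exists_inner hk
  refine ⟨H, i1, i2, i3, fun x => q ⟨x⟩, fun x => p ⟨x⟩, ?_, ?_, fun x y => (hpq _ _).symm, ?_⟩
  · exact ⟨√k, by rintro _ ⟨x, rfl⟩; exact (hq _).le⟩
  · exact ⟨√k, by rintro _ ⟨x, rfl⟩; exact (hp _).le⟩
  · simp [hp, hq, Real.mul_self_sqrt hk]

end SchurNorm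

/-! ### Weak continuity and local countability of coordinates -/

section Continuity

variable {H : Type*} [NormedAddCommGroup H] [InnerProductSpace ℂ H]
  {X : Type*} [TopologicalSpace X]

/-- A bounded map into a Hilbert space that is continuous when tested against a total set is weakly
continuous. -/
theorem continuous_inner_of_dense {ξ : X → H} {C : ℝ} (hC : ∀ x, ‖ξ x‖ ≤ C) {D : Set H}
    (hD : ∀ v ∈ D, Continuous fun x => ⟪v, ξ x⟫_ℂ)
    (hd : (Submodule.span ℂ D).topologicalClosure = ⊤) (v : H) :
    Continuous fun x => ⟪v, ξ x⟫_ℂ := by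
  have hspan : ∀ w ∈ Submodule.span ℂ D, Continuous fun x => ⟪w, ξ x⟫_ℂ := by
    intro w hw
    induction hw using Submodule.span_induction with
    | mem w hw => exact hD w hw
    | zero => simpa using continuous_const
    | add w z _ _ hw hz => simp only [inner_add_left]; fun_prop
    | smul c w _ hw => simp only [inner_smul_left]; fun_prop
  -- Boundedness of ξ makes the approximation of `v` by the span uniform in `x`.
  refine continuous_of_uniform_approx_of_continuous fun U hU => ?_
  obtain ⟨ε, hε, hεU⟩ := Metric.mem_uniformity_dist.1 hU
  have hv : v ∈ closure (Submodule.span ℂ D : Set H) := by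
    rw [← Submodule.topologicalClosure_coe, hd]; trivial
  have hC' : 0 < |C| + 1 := by positivity
  obtain ⟨w, hw, hvw⟩ := Metric.mem_closure_iff.1 hv (ε / (|C| + 1)) (by positivity)
  refine ⟨_, hspan w hw, fun x => hεU ?_⟩
  rw [dist_eq_norm, ← inner_sub_left]
  refine (norm_inner_le_norm _ _).trans_lt ?_
  rw [dist_eq_norm, lt_div_iff₀ hC'] at hvw
  refine lt_of_le_of_lt (mul_le_mul_of_nonneg_left ?_ (norm_nonneg _)) hvw
  linarith [hC x, le_abs_self C]

/-- By Bessel, the integrals of |⟨ξ, eᵢ⟩|² over an open `U` of finite measure have a finite sum, so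
all but countably many vanish. A continuous coordinate that is nonzero somewhere in `U` has positive
integral, as μ charges open sets. -/
theorem locallyCountable_inner [MeasurableSpace X] [OpensMeasurableSpace X] (μ : Measure X)
    [IsLocallyFiniteMeasure μ] [μ.IsOpenPosMeasure] {ξ : X → H} {C : ℝ} (hC : ∀ x, ‖ξ x‖ ≤ C)
    {ι : Type*} {e : ι → H} (he : Orthonormal ℂ e) (hc : ∀ i, Continuous fun x => ⟪e i, ξ x⟫_ℂ) :
    LocallyCountable fun i x => ⟪e i, ξ x⟫_ℂ := by
  intro x
  obtain ⟨U, hxU, hUo, hU⟩ := μ.exists_isOpen_measure_lt_top x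
  refine ⟨U, hUo.mem_nhds hxU, ?_⟩
  have hsum : ∑' i, ∫⁻ y in U, ‖⟪e i, ξ y⟫_ℂ‖ₑ ^ 2 ∂μ ≠ ∞ := by
    refine ne_top_of_le_ne_top (b := ENNReal.ofReal (C ^ 2) * μ U)
      (ENNReal.mul_ne_top ENNReal.ofReal_ne_top hU.ne) ?_
    rw [ENNReal.tsum_eq_iSup_sum]
    refine iSup_le fun s => ?_
    rw [← lintegral_finsetSum s fun i _ => (hc i).enorm.measurable.pow_const 2, ← setLIntegral_const]
    refine lintegral_mono fun y => ?_
    have h1 : ∑ i ∈ s, ‖⟪e i, ξ y⟫_ℂ‖ ^ 2 ≤ C ^ 2 :=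
      (he.sum_inner_products_le (ξ y)).trans (by gcongr; exact hC y)
    simp only [← ofReal_norm, ← ENNReal.ofReal_pow (norm_nonneg _)]
    rw [← ENNReal.ofReal_sum_of_nonneg fun i _ => by positivity]
    exact ENNReal.ofReal_le_ofReal h1
  refine (Summable.countable_support_ennreal hsum).mono ?_
  rintro i ⟨y, hy, hne⟩
  rw [Function.mem_support, ← pos_iff_ne_zero,
    setLIntegral_pos_iff ((hc i).enorm.measurable.pow_const 2)]
  have hopen : IsOpen (U ∩ {z | ⟪e i, ξ z⟫_ℂ ≠ 0}) :=
    hUo.inter (isOpen_ne.preimage (hc i))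
  refine (hopen.measure_pos μ ⟨y, hy, hne⟩).trans_le (measure_mono ?_)
  rintro z ⟨hz, hz'⟩
  exact ⟨by simpa using hz', hz⟩

variable {G : Type*} [Group G]

theorem IsGilbertPair.norm_le_left {φ : G → ℂ} {k : ℝ} {ξ η : G → H} (h : IsGilbertPair φ k ξ η)
    (x : G) : ‖ξ x‖ ≤ ⨆ x, ‖ξ x‖ := le_ciSup h.1 x

theorem IsGilbertPair.norm_le_right {φ : G → ℂ} {k : ℝ} {ξ η : G → H} (h : IsGilbertPair φ k ξ η)
    (x : G) : ‖η x‖ ≤ ⨆ x, ‖η x‖ := le_ciSup h.2.1 x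

/-- A representing pair can be compressed to a subspace in which both maps have total range. -/
theorem IsGilbertPair.exists_total {H : Type v} [NormedAddCommGroup H] [InnerProductSpace ℂ H]
    [CompleteSpace H] {φ : G → ℂ} {k : ℝ} {ξ η : G → H} (h : IsGilbertPair φ k ξ η) :
    ∃ (H' : Type v) (_ : NormedAddCommGroup H') (_ : InnerProductSpace ℂ H') (_ : CompleteSpace H')
      (ξ' η' : G → H'), IsGilbertPair φ k ξ' η' ∧
        (Submodule.span ℂ (Set.range ξ')).topologicalClosure = ⊤ ∧
        (Submodule.span ℂ (Set.range η')).topologicalClosure = ⊤ := by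
  -- Projecting η to `H₁` keeps its inner products with ξ; projecting ξ to the closed span `H₂` of ζ
  -- keeps those with ζ. The projected ξ is total because `H₂ ≤ H₁`.
  let H₁ : Submodule ℂ H := (Submodule.span ℂ (Set.range ξ)).topologicalClosure
  have hξ₁ : ∀ x, ξ x ∈ H₁ := fun x =>
    Submodule.le_topologicalClosure _ (Submodule.subset_span ⟨x, rfl⟩)
  have : CompleteSpace H₁ := (Submodule.isClosed_topologicalClosure _).completeSpace_coe
  let ζ : G → H := fun y => H₁.starProjection (η y)
  let H₂ : Submodule ℂ H := (Submodule.span ℂ (Set.range ζ)).topologicalClosure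
  have : CompleteSpace H₂ := (Submodule.isClosed_topologicalClosure _).completeSpace_coe
  have hζ₂ : ∀ x, ζ x ∈ H₂ := fun x =>
    Submodule.le_topologicalClosure _ (Submodule.subset_span ⟨x, rfl⟩)
  have hH₂ : H₂ ≤ H₁ := Submodule.topologicalClosure_minimal _
    (Submodule.span_le.2 (by rintro _ ⟨x, rfl⟩; exact H₁.starProjection_apply_mem _))
    (Submodule.isClosed_topologicalClosure _)
  let ξ' : G → H₂ := fun x => H₂.orthogonalProjectionOnto (ξ x)
  let η' : G → H₂ := fun y => ⟨ζ y, hζ₂ y⟩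
  have hξn : ∀ x, ‖ξ' x‖ ≤ ‖ξ x‖ := fun x => H₂.norm_orthogonalProjectionOnto_apply_le _
  have hηn : ∀ x, ‖η' x‖ ≤ ‖η x‖ := fun x => H₁.norm_orthogonalProjectionOnto_apply_le _
  have hin : ∀ (w : H₂) (x : G), ⟪w, ξ' x⟫_ℂ = ⟪(w : H), ξ x⟫_ℂ := fun w x =>
    Submodule.inner_orthogonalProjectionOnto_eq_of_mem_left _ _
  refine ⟨H₂, inferInstance, inferInstance, inferInstance, ξ', η', ⟨?_, ?_, ?_, ?_⟩, ?_, ?_⟩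
  · exact ⟨_, by rintro _ ⟨x, rfl⟩; exact (hξn x).trans (h.norm_le_left x)⟩
  · exact ⟨_, by rintro _ ⟨x, rfl⟩; exact (hηn x).trans (h.norm_le_right x)⟩
  · intro x y
    rw [hin, h.2.2.1]
    change _ = ⟪H₁.starProjection (η y), ξ x⟫_ℂ
    rw [Submodule.inner_starProjection_left_eq_right,
      Submodule.starProjection_eq_self_iff.2 (hξ₁ x)]
  · refine le_trans (mul_le_mul ?_ ?_ ?_ ?_) h.2.2.2
    · exact ciSup_mono h.1 hξn
    · exact ciSup_mono h.2.1 hηn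
    · exact Real.iSup_nonneg fun _ => norm_nonneg _
    · exact Real.iSup_nonneg fun _ => norm_nonneg _
  · rw [Submodule.topologicalClosure_eq_top_iff, Submodule.eq_bot_iff]
    intro w hw
    have h1 : ∀ x, ⟪ξ x, (w : H)⟫_ℂ = 0 := fun x => by
      rw [← inner_conj_symm, ← hin, inner_conj_symm]
      exact hw _ (Submodule.subset_span ⟨x, rfl⟩)
    have h2 : (w : H) ∈ (Submodule.span ℂ (Set.range ξ))ᗮ := by
      rw [Submodule.mem_orthogonal]
      intro z hz
      induction hz using Submodule.span_induction with
      | mem z hz => obtain ⟨x, rfl⟩ := hz; exact h1 x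
      | zero => simp
      | add a b _ _ ha hb => rw [inner_add_left, ha, hb, add_zero]
      | smul c a _ ha => rw [inner_smul_left, ha, mul_zero]
    rw [← Submodule.orthogonal_closure] at h2
    have h3 := inner_self_eq_zero.1 (h2 _ (hH₂ w.2))
    exact Subtype.ext h3
  · rw [Submodule.topologicalClosure_eq_top_iff, Submodule.eq_bot_iff]
    intro w hw
    have h2 : (w : H) ∈ (Submodule.span ℂ (Set.range ζ))ᗮ := by
      rw [Submodule.mem_orthogonal]
      intro z hz
      induction hz using Submodule.span_induction with
      | mem z hz =>
        obtain ⟨x, rfl⟩ := hz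
        exact hw (η' x) (Submodule.subset_span ⟨x, rfl⟩)
      | zero => simp
      | add a b _ _ ha hb => rw [inner_add_left, ha, hb, add_zero]
      | smul c a _ ha => rw [inner_smul_left, ha, mul_zero]
    rw [← Submodule.orthogonal_closure] at h2
    exact Subtype.ext (inner_self_eq_zero.1 (h2 _ w.2))

theorem IsGilbertPair.exists_hasGoodCoordinates [TopologicalSpace G] [IsTopologicalGroup G]
    [LocallyCompactSpace G] [MeasurableSpace G] [BorelSpace G] (μ : Measure G) [μ.IsHaarMeasure]
    {H : Type v} [NormedAddCommGroup H] [InnerProductSpace ℂ H]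
    [CompleteSpace H] {φ : G → ℂ} (hφ : Continuous φ) {k : ℝ} {ξ η : G → H}
    (h : IsGilbertPair φ k ξ η) :
    ∃ (H' : Type v) (_ : NormedAddCommGroup H') (_ : InnerProductSpace ℂ H') (_ : CompleteSpace H')
      (ξ' η' : G → H'), IsGilbertPair φ k ξ' η' ∧ ∀ (ι : Type v) (e : HilbertBasis ι ℂ H'),
        HasGoodCoordinates e ξ' ∧ HasGoodCoordinates e η' := by
  obtain ⟨H', i1, i2, i3, ξ', η', h', hξ, hη⟩ := h.exists_total
  have hcξ : ∀ v, Continuous fun x => ⟪v, ξ' x⟫_ℂ :=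
    -- Against the total vectors `η' y` the coordinate of `ξ'` is φ(y⁻¹x).
    continuous_inner_of_dense h'.norm_le_left (by
      rintro _ ⟨y, rfl⟩
      simp only [← h'.2.2.1]
      fun_prop) hη
  have hcη : ∀ v, Continuous fun x => ⟪v, η' x⟫_ℂ :=
    continuous_inner_of_dense h'.norm_le_right (by
      rintro _ ⟨y, rfl⟩
      have : (fun x => ⟪ξ' y, η' x⟫_ℂ) = fun x => conj (φ (x⁻¹ * y)) := by
        funext x
        rw [h'.2.2.1, inner_conj_symm]
      rw [this]
      exact Complex.continuous_conj.comp (by fun_prop)) hξ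
  exact ⟨H', i1, i2, i3, ξ', η', h', fun ι e =>
    ⟨⟨fun i => hcξ _, locallyCountable_inner μ h'.norm_le_left e.orthonormal fun i => hcξ _⟩,
      ⟨fun i => hcη _, locallyCountable_inner μ h'.norm_le_right e.orthonormal fun i => hcη _⟩⟩⟩

end Continuity

/-! ### Square-summable families -/

section SquareSummable

variable {H κ : Type*} [NormedAddCommGroup H]

theorem sum_sq_le_norm_sq (f : lp (fun _ : κ => H) 2) (s : Finset κ) :
    ∑ i ∈ s, ‖f i‖ ^ 2 ≤ ‖f‖ ^ 2 := by
  simpa using lp.sum_rpow_le_norm_rpow (p := 2) (by simp) f s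

theorem norm_le_of_forall_sum_sq_le {f : lp (fun _ : κ => H) 2} {C : ℝ} (hC : 0 ≤ C)
    (h : ∀ s : Finset κ, ∑ i ∈ s, ‖f i‖ ^ 2 ≤ C ^ 2) : ‖f‖ ≤ C :=
  lp.norm_le_of_forall_sum_le (by simp) hC fun s => by simpa using h s

theorem memℓp_two_of_forall_sum_sq_le {f : κ → H} {C : ℝ}
    (h : ∀ s : Finset κ, ∑ i ∈ s, ‖f i‖ ^ 2 ≤ C) : Memℓp f 2 :=
  memℓp_gen' (C := C) fun s => by simpa using h s

theorem memℓp_two_iff_summable_sq {f : κ → H} : Memℓp f 2 ↔ Summable fun i => ‖f i‖ ^ 2 := by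
  rw [memℓp_gen_iff (by simp)]
  simp

end SquareSummable

/-! ### Amplifications, normal functionals and the bicommutant -/

section Amplification

variable {H K : Type*} [NormedAddCommGroup H] [InnerProductSpace ℂ H]
  [NormedAddCommGroup K] [InnerProductSpace ℂ K] {κ κ' : Type*}

/-- The column operator `v ↦ (Aᵢ v)ᵢ` with values in a Hilbert sum. -/
noncomputable def column (A : κ → H →L[ℂ] K) (C : ℝ) (hC : 0 ≤ C)
    (h : ∀ (s : Finset κ) (v : H), ∑ i ∈ s, ‖A i v‖ ^ 2 ≤ (C * ‖v‖) ^ 2) :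
    H →L[ℂ] lp (fun _ : κ => K) 2 :=
  LinearMap.mkContinuous
    { toFun := fun v => ⟨fun i => A i v, memℓp_two_of_forall_sum_sq_le fun s => h s v⟩
      map_add' := fun v w => lp.ext (funext fun i => map_add (A i) v w)
      map_smul' := fun c v => lp.ext (funext fun i => map_smul (A i) c v) } C
    fun v => norm_le_of_forall_sum_sq_le (by positivity) fun s => h s v

theorem norm_column_le (A : κ → H →L[ℂ] K) (C : ℝ) (hC : 0 ≤ C)
    (h : ∀ (s : Finset κ) (v : H), ∑ i ∈ s, ‖A i v‖ ^ 2 ≤ (C * ‖v‖) ^ 2) :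
    ‖column A C hC h‖ ≤ C :=
  LinearMap.mkContinuous_norm_le _ hC _

variable (H) in
/-- The coordinate projections of a Hilbert sum. -/
noncomputable def coord (i : κ) : lp (fun _ : κ => H) 2 →L[ℂ] H :=
  LinearMap.mkContinuous
    { toFun := fun v => v i
      map_add' := fun v w => by simp
      map_smul' := fun c v => by simp } 1
    fun v => by
      rw [one_mul]
      exact lp.norm_apply_le_norm (by simp) v i

@[simp]
theorem coord_apply (i : κ) (v : lp (fun _ : κ => H) 2) : coord H i v = v i := rfl

variable (κ) in
/-- The amplification `T ⊗ 1` of an operator to a Hilbert sum. -/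
noncomputable def ampl (T : H →L[ℂ] K) : lp (fun _ : κ => H) 2 →L[ℂ] lp (fun _ : κ => K) 2 :=
  column (fun i => T ∘L coord H i) ‖T‖ (norm_nonneg _) fun s v => by
    rw [mul_pow]
    refine le_trans ?_ (mul_le_mul_of_nonneg_left (sum_sq_le_norm_sq v s) (sq_nonneg _))
    rw [Finset.mul_sum]
    refine Finset.sum_le_sum fun i _ => ?_
    rw [← mul_pow]
    exact pow_le_pow_left₀ (norm_nonneg _) (T.le_opNorm _) 2

@[simp]
theorem ampl_apply (T : H →L[ℂ] K) (v : lp (fun _ : κ => H) 2) (i : κ) :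
    ampl κ T v i = T (v i) := rfl

theorem norm_ampl_le (T : H →L[ℂ] K) : ‖ampl κ T‖ ≤ ‖T‖ := norm_column_le _ _ _ _

theorem ampl_single [DecidableEq κ] (T : H →L[ℂ] K) (i : κ) (x : H) :
    ampl κ T (lp.single 2 i x) = lp.single 2 i (T x) := by
  ext j
  rw [ampl_apply, lp.single_apply, lp.single_apply]
  by_cases h : j = i
  · subst h; simp
  · simp [h]

theorem hasSum_inner_ampl (T : H →L[ℂ] K) (G : lp (fun _ : κ => K) 2)
    (F : lp (fun _ : κ => H) 2) : HasSum (fun i => ⟪G i, T (F i)⟫_ℂ) ⟪G, ampl κ T F⟫_ℂ :=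
  lp.hasSum_inner G (ampl κ T F)

/-- The juxtaposition of two elements of Hilbert sums. -/
noncomputable def sumElim (F : lp (fun _ : κ => H) 2) (F' : lp (fun _ : κ' => H) 2) :
    lp (fun _ : κ ⊕ κ' => H) 2 :=
  ⟨Sum.elim F F', memℓp_two_iff_summable_sq.2
    ((memℓp_two_iff_summable_sq.1 F.2).hasSum.sum (f := fun i => ‖Sum.elim F F' i‖ ^ 2)
      (memℓp_two_iff_summable_sq.1 F'.2).hasSum).summable⟩

theorem inner_ampl_sumElim (T : H →L[ℂ] H) (G F : lp (fun _ : κ => H) 2)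
    (G' F' : lp (fun _ : κ' => H) 2) :
    ⟪sumElim G G', ampl _ T (sumElim F F')⟫_ℂ = ⟪G, ampl κ T F⟫_ℂ + ⟪G', ampl κ' T F'⟫_ℂ := by
  refine (hasSum_inner_ampl T (sumElim G G') (sumElim F F')).unique (HasSum.sum ?_ ?_)
  · exact hasSum_inner_ampl T G F
  · exact hasSum_inner_ampl T G' F'

theorem adjoint_ampl [CompleteSpace H] [CompleteSpace K] (T : H →L[ℂ] K) :
    ContinuousLinearMap.adjoint (ampl κ T) = ampl κ (ContinuousLinearMap.adjoint T) := by
  symm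
  rw [ContinuousLinearMap.eq_adjoint_iff]
  intro x y
  refine (lp.hasSum_inner (ampl κ (ContinuousLinearMap.adjoint T) x) y).unique ?_
  convert lp.hasSum_inner x (ampl κ T y) using 2 with i
  simp [ContinuousLinearMap.adjoint_inner_left]

variable [CompleteSpace H]

/-- The form in which the bicommutant theorem is used: an element of the bicommutant of a self-adjoint
monoid of operators, amplified to a Hilbert sum, preserves the closed cyclic subspaces. -/
theorem ampl_mem_closure_span {S : Set (H →L[ℂ] H)} (hone : 1 ∈ S)
    (hmul : ∀ s ∈ S, ∀ t ∈ S, s * t ∈ S) (hstar : ∀ s ∈ S, star s ∈ S) {T : H →L[ℂ] H}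
    (hT : T ∈ Set.centralizer (Set.centralizer (S ∪ star S))) (a : lp (fun _ : κ => H) 2) :
    ampl κ T a ∈ (Submodule.span ℂ ((fun s => ampl κ s a) '' S)).topologicalClosure := by
  classical
  set W := (Submodule.span ℂ ((fun s => ampl κ s a) '' S)).topologicalClosure with hW
  have : CompleteSpace W := (Submodule.isClosed_topologicalClosure _).completeSpace_coe
  set P := W.starProjection with hP
  have hinv : ∀ s ∈ S, ∀ w ∈ W, ampl κ s w ∈ W := by
    intro s hs w hw
    refine map_mem_closure (ampl κ s).continuous hw fun z hz => ?_
    change z ∈ Submodule.span ℂ _ at hz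
    change _ ∈ Submodule.span ℂ _
    induction hz using Submodule.span_induction with
    | mem z hz =>
      obtain ⟨t, ht, rfl⟩ := hz
      exact Submodule.subset_span ⟨s * t, hmul s hs t ht, rfl⟩
    | zero => simp
    | add x y _ _ hx hy => rw [map_add]; exact add_mem hx hy
    | smul c x _ hx => rw [map_smul]; exact Submodule.smul_mem _ _ hx
  -- As `S` is self-adjoint, the orthogonal complement of `W` is invariant too.
  have hcomm : ∀ s ∈ S, ∀ v, P (ampl κ s v) = ampl κ s (P v) := by
    intro s hs v
    have h1 : P (ampl κ s (P v)) = ampl κ s (P v) :=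
      Submodule.starProjection_eq_self_iff.2 (hinv s hs _ (W.starProjection_apply_mem v))
    have h2 : P (ampl κ s (v - P v)) = 0 := by
      rw [hP, Submodule.starProjection_apply_eq_zero_iff, Submodule.mem_orthogonal]
      intro w hw
      rw [← ContinuousLinearMap.adjoint_inner_left, adjoint_ampl]
      exact (Submodule.mem_orthogonal _ _).1 (W.sub_starProjection_mem_orthogonal v) _
        (hinv _ (hstar s hs) w hw)
    rw [← sub_eq_zero, ← h1, ← map_sub, ← map_sub, h2]
  -- Since `P` commutes with each s ⊗ 1, its matrix entries lie in the commutant and hence commute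
  -- with `T`; so `P` commutes with T ⊗ 1.
  have hentry : ∀ i j : κ, coord H i ∘L P ∘L (lp.singleContinuousLinearMap ℂ (fun _ => H) 2 j) ∈
      Set.centralizer (S ∪ star S) := by
    intro i j s hs
    have hs' : s ∈ S := by
      rcases hs with hs | hs
      · exact hs
      · simpa using hstar _ hs
    ext x
    simp only [mul_apply_eq_comp, ContinuousLinearMap.comp_apply,
      lp.singleContinuousLinearMap_apply, coord_apply]
    rw [← ampl_single, hcomm s hs', ampl_apply]
  have hcommT : ∀ v, P (ampl κ T v) = ampl κ T (P v) := by
    intro v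
    have h1 := lp.hasSum_single (p := 2) (by simp) v
    have h2 := ((P ∘L ampl κ T).hasSum h1)
    have h3 := ((ampl κ T ∘L P).hasSum h1)
    refine h2.unique ?_
    rw [← ContinuousLinearMap.comp_apply (ampl κ T) P]
    convert! h3 using 1
    funext j
    ext i
    have h4 := DFunLike.congr_fun (hT _ (hentry i j)) (v j)
    simp only [mul_apply_eq_comp, ContinuousLinearMap.comp_apply,
      lp.singleContinuousLinearMap_apply, coord_apply] at h4
    simp only [ContinuousLinearMap.comp_apply, ampl_single, ampl_apply]
    exact h4
  have ha : a ∈ W := Submodule.le_topologicalClosure _ (Submodule.subset_span ⟨1, hone, rfl⟩)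
  have hPa : P a = a := Submodule.starProjection_eq_self_iff.2 ha
  rw [← hPa, ← hcommT]
  exact W.starProjection_apply_mem _

theorem inner_ampl_eq_zero {S : Set (H →L[ℂ] H)} (hone : 1 ∈ S)
    (hmul : ∀ s ∈ S, ∀ t ∈ S, s * t ∈ S) (hstar : ∀ s ∈ S, star s ∈ S) {T : H →L[ℂ] H}
    (hT : T ∈ Set.centralizer (Set.centralizer (S ∪ star S))) (G F : lp (fun _ : κ => H) 2)
    (h : ∀ s ∈ S, ⟪G, ampl κ s F⟫_ℂ = 0) : ⟪G, ampl κ T F⟫_ℂ = 0 := by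
  have h1 := ampl_mem_closure_span hone hmul hstar hT F
  have h2 : G ∈ (Submodule.span ℂ ((fun s => ampl κ s F) '' S))ᗮ := by
    rw [Submodule.mem_orthogonal']
    intro z hz
    induction hz using Submodule.span_induction with
    | mem z hz => obtain ⟨s, hs, rfl⟩ := hz; exact h s hs
    | zero => simp
    | add a b _ _ ha hb => rw [inner_add_right, ha, hb, add_zero]
    | smul c a _ ha => rw [inner_smul_right, ha, mul_zero]
  rw [← Submodule.orthogonal_closure] at h2
  exact (Submodule.mem_orthogonal' _ _).1 h2 _ h1

/-- Normal functionals that agree on a self-adjoint monoid agree on its bicommutant. -/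
theorem inner_ampl_eq {S : Set (H →L[ℂ] H)} (hone : 1 ∈ S)
    (hmul : ∀ s ∈ S, ∀ t ∈ S, s * t ∈ S) (hstar : ∀ s ∈ S, star s ∈ S) {T : H →L[ℂ] H}
    (hT : T ∈ Set.centralizer (Set.centralizer (S ∪ star S))) (G F : lp (fun _ : κ => H) 2)
    (G' F' : lp (fun _ : κ' => H) 2)
    (h : ∀ s ∈ S, ⟪G, ampl κ s F⟫_ℂ = ⟪G', ampl κ' s F'⟫_ℂ) :
    ⟪G, ampl κ T F⟫_ℂ = ⟪G', ampl κ' T F'⟫_ℂ := by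
  -- The difference of the two functionals is a single functional on the juxtaposed sums.
  have := inner_ampl_eq_zero hone hmul hstar hT (sumElim G (-G')) (sumElim F F') fun s hs => by
    rw [inner_ampl_sumElim, h s hs, inner_neg_left, add_neg_cancel]
  rw [inner_ampl_sumElim, inner_neg_left, add_neg_eq_zero] at this
  exact this

theorem inPredual_iff_exists_lp {M : VonNeumannAlgebra H} {ω : M.toStarSubalgebra →ₗ[ℂ] ℂ} :
    InPredual M ω ↔ ∃ F G : lp (fun _ : ℕ => H) 2,
      ∀ T : M.toStarSubalgebra, ω T = ⟪G, ampl ℕ (T : H →L[ℂ] H) F⟫_ℂ := by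
  constructor
  · rintro ⟨f, g, hf, hg, h⟩
    exact ⟨⟨f, memℓp_two_iff_summable_sq.2 hf⟩, ⟨g, memℓp_two_iff_summable_sq.2 hg⟩,
      fun T => (h T).unique (hasSum_inner_ampl _ _ _)⟩
  · rintro ⟨F, G, h⟩
    exact ⟨F, G, memℓp_two_iff_summable_sq.1 F.2, memℓp_two_iff_summable_sq.1 G.2,
      fun T => by rw [h]; exact hasSum_inner_ampl _ _ _⟩

/-- Only countably many `F i` are nonzero, so any index set can be replaced by `ℕ`, padding with
zeros. -/
theorem inPredual_of_lp {M : VonNeumannAlgebra H} {ω : M.toStarSubalgebra →ₗ[ℂ] ℂ}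
    (F G : lp (fun _ : κ => H) 2)
    (h : ∀ T : M.toStarSubalgebra, ω T = ⟪G, ampl κ (T : H →L[ℂ] H) F⟫_ℂ) : InPredual M ω := by
  have hF := memℓp_two_iff_summable_sq.1 F.2
  have hG := memℓp_two_iff_summable_sq.1 G.2
  have hc : (Function.support fun i => ‖F i‖ ^ 2).Countable := hF.countable_support
  set s := Function.support fun i => ‖F i‖ ^ 2 with hs
  have : Countable s := hc.to_subtype
  obtain ⟨j, hj⟩ := exists_injective_nat s
  have hext : ∀ E : lp (fun _ : κ => H) 2, ∀ n,
      ‖Function.extend j (fun i : s => E i) 0 n‖ ^ 2 =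
        Function.extend j (fun i : s => ‖E i‖ ^ 2) 0 n := by
    intro E n
    by_cases hn : ∃ i, j i = n
    · obtain ⟨i, rfl⟩ := hn
      simp [hj.extend_apply]
    · simp [Function.extend_apply' _ _ _ hn]
  refine ⟨Function.extend j (fun i : s => F i) 0, Function.extend j (fun i : s => G i) 0, ?_, ?_,
    fun T => ?_⟩
  · simp only [hext]
    exact (hasSum_extend_zero hj).2 (hF.subtype s).hasSum |>.summable
  · simp only [hext]
    exact (hasSum_extend_zero hj).2 (hG.subtype s).hasSum |>.summable
  · have h1 := hasSum_inner_ampl (T : H →L[ℂ] H) G F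
    rw [← h, ← hasSum_subtype_iff_of_support_subset (s := s), ← hasSum_extend_zero hj] at h1
    · convert h1 using 1
      funext n
      by_cases hn : ∃ i, j i = n
      · obtain ⟨i, rfl⟩ := hn
        simp [hj.extend_apply]
      · simp [Function.extend_apply' _ _ _ hn]
    · intro i hi
      rw [hs, Function.mem_support]
      intro h0
      have : F i = 0 := by simpa using h0
      simp [this] at hi

theorem InPredual.eq_of_eqOn {S : Set (H →L[ℂ] H)} (hone : 1 ∈ S)
    (hmul : ∀ s ∈ S, ∀ t ∈ S, s * t ∈ S) (hstar : ∀ s ∈ S, star s ∈ S)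
    {ω ω' : (generatedVonNeumannAlgebra S).toStarSubalgebra →ₗ[ℂ] ℂ}
    (hω : InPredual _ ω) (hω' : InPredual _ ω')
    (h : ∀ s (hs : s ∈ S), ω ⟨s, mem_generatedVonNeumannAlgebra hs⟩ =
      ω' ⟨s, mem_generatedVonNeumannAlgebra hs⟩) : ω = ω' := by
  obtain ⟨F, G, hFG⟩ := inPredual_iff_exists_lp.1 hω
  obtain ⟨F', G', hFG'⟩ := inPredual_iff_exists_lp.1 hω'
  ext T
  rw [hFG, hFG']
  refine inner_ampl_eq hone hmul hstar T.2 _ _ _ _ fun s hs => ?_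
  have := h s hs
  rwa [hFG, hFG'] at this

end Amplification

/-! ### The maps T ↦ W*(T ⊗ 1)V -/

section Compression

variable {H K : Type*} [NormedAddCommGroup H] [InnerProductSpace ℂ H] [CompleteSpace H]
  [NormedAddCommGroup K] [InnerProductSpace ℂ K] [CompleteSpace K] {ι : Type*}

/-- The normal completely bounded map `T ↦ W* (T ⊗ 1) V`. -/
noncomputable def compression (V W : H →L[ℂ] lp (fun _ : ι => K) 2) :
    (K →L[ℂ] K) →ₗ[ℂ] (H →L[ℂ] H) where
  toFun T := ContinuousLinearMap.adjoint W ∘L ampl ι T ∘L V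
  map_add' S T := by
    ext x
    have : ampl ι (S + T) (V x) = ampl ι S (V x) + ampl ι T (V x) := by ext i; simp
    simp [this]
  map_smul' c T := by
    ext x
    have : ampl ι (c • T) (V x) = c • ampl ι T (V x) := by ext i; simp
    simp [this]

theorem inner_compression (V W : H →L[ℂ] lp (fun _ : ι => K) 2) (T : K →L[ℂ] K) (g f : H) :
    ⟪g, compression V W T f⟫_ℂ = ⟪W g, ampl ι T (V f)⟫_ℂ := by
  simp [compression, ContinuousLinearMap.adjoint_inner_right]

/-- After interchanging the `n`-fold sum with the sum over `ι`, the matrix of compressions is W'*(a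
⊗ 1)V', where `V'` and `W'` act as `V` and `W` in each of the `n` components and have no larger
norm. -/
theorem norm_matrixOperator_compression_le {n : ℕ} (V W : H →L[ℂ] lp (fun _ : ι => K) 2)
    (a : Matrix (Fin n) (Fin n) (K →L[ℂ] K)) :
    ‖matrixOperator (a.map (compression V W))‖ ≤ ‖W‖ * ‖matrixOperator a‖ * ‖V‖ := by
  have hcol : ∀ (U : H →L[ℂ] lp (fun _ : ι => K) 2), ∃ U' : PiLp 2 (fun _ : Fin n => H) →L[ℂ]
      lp (fun _ : ι => PiLp 2 (fun _ : Fin n => K)) 2, ‖U'‖ ≤ ‖U‖ ∧ ∀ v k j, U' v k j = U (v j) k := by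
    intro U
    refine ⟨column (fun k => ((PiLp.continuousLinearEquiv 2 ℂ (fun _ : Fin n => K)).symm :
      (Fin n → K) →L[ℂ] PiLp 2 (fun _ : Fin n => K)) ∘L ContinuousLinearMap.pi
      (fun j => coord K k ∘L U ∘L PiLp.proj (𝕜 := ℂ) 2 (fun _ : Fin n => H) j)) ‖U‖
      U.opNorm_nonneg ?_, norm_column_le _ _ _ _, fun v k j => rfl⟩
    intro s v
    rw [mul_pow, PiLp.norm_sq_eq_of_L2, Finset.mul_sum]
    simp only [PiLp.norm_sq_eq_of_L2]
    rw [Finset.sum_comm]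
    refine Finset.sum_le_sum fun j _ => ?_
    refine le_trans (le_of_eq ?_) ((sum_sq_le_norm_sq (U (v j)) s).trans ?_)
    · simp
    · rw [← mul_pow]
      exact pow_le_pow_left₀ (norm_nonneg _) (U.le_opNorm _) 2
  obtain ⟨V', hV, hV'⟩ := hcol V
  obtain ⟨W', hW, hW'⟩ := hcol W
  have key : matrixOperator (a.map (compression V W)) =
      ContinuousLinearMap.adjoint W' ∘L ampl ι (matrixOperator a) ∘L V' := by
    ext1 v
    refine ext_inner_left ℂ fun w => ?_
    rw [ContinuousLinearMap.comp_apply, ContinuousLinearMap.adjoint_inner_right,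
      ContinuousLinearMap.comp_apply, PiLp.inner_apply]
    simp only [matrixOperator_apply, Matrix.map_apply, inner_sum, inner_compression]
    have h1 : HasSum (fun k => ∑ i, ∑ j, ⟪W (w i) k, a i j (V (v j) k)⟫_ℂ)
        (∑ i, ∑ j, ⟪W (w i), ampl ι (a i j) (V (v j))⟫_ℂ) :=
      hasSum_sum fun i _ => hasSum_sum fun j _ => hasSum_inner_ampl _ _ _
    refine h1.unique ?_
    convert hasSum_inner_ampl (matrixOperator a) (W' w) (V' v) using 2 with k
    simp only [PiLp.inner_apply, matrixOperator_apply, hV', hW', inner_sum]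
  rw [key]
  refine (ContinuousLinearMap.opNorm_comp_le _ _).trans ?_
  rw [LinearIsometryEquiv.norm_map, mul_assoc]
  refine mul_le_mul hW ?_ (ContinuousLinearMap.opNorm_nonneg _) W.opNorm_nonneg
  refine (ContinuousLinearMap.opNorm_comp_le _ _).trans ?_
  exact mul_le_mul (norm_ampl_le _) hV (ContinuousLinearMap.opNorm_nonneg _) (norm_nonneg _)

end Compression

/-! ### Compressions that preserve a von Neumann algebra -/

section NormalMaps

variable {H : Type*} [NormedAddCommGroup H] [InnerProductSpace ℂ H] [CompleteSpace H] {ι : Type*}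

/-- For `R` in the commutant, the coefficients of RΦ(T) and Φ(T)R are normal in `T` and agree on
`S`, hence on the bicommutant. -/
theorem compression_mem {S : Set (H →L[ℂ] H)} (hone : 1 ∈ S)
    (hmul : ∀ s ∈ S, ∀ t ∈ S, s * t ∈ S) (hstar : ∀ s ∈ S, star s ∈ S)
    (V W : H →L[ℂ] lp (fun _ : ι => H) 2)
    (h : ∀ s ∈ S, compression V W s ∈ (generatedVonNeumannAlgebra S).toStarSubalgebra)
    {T : H →L[ℂ] H} (hT : T ∈ (generatedVonNeumannAlgebra S).toStarSubalgebra) :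
    compression V W T ∈ (generatedVonNeumannAlgebra S).toStarSubalgebra := by
  intro R hR
  have key : ∀ (T : H →L[ℂ] H) (g f : H),
      ⟪g, (R * compression V W T) f⟫_ℂ =
        ⟪W (ContinuousLinearMap.adjoint R g), ampl ι T (V f)⟫_ℂ ∧
      ⟪g, (compression V W T * R) f⟫_ℂ = ⟪W g, ampl ι T (V (R f))⟫_ℂ := fun T g f => by
    rw [mul_apply_eq_comp, mul_apply_eq_comp, ← ContinuousLinearMap.adjoint_inner_left,
      inner_compression, inner_compression]
    exact ⟨rfl, rfl⟩
  ext f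
  refine ext_inner_left ℂ fun g => ?_
  rw [(key T g f).1, (key T g f).2]
  refine inner_ampl_eq hone hmul hstar hT _ _ _ _ fun s hs => ?_
  rw [← (key s g f).1, ← (key s g f).2]
  exact congrArg (fun A : H →L[ℂ] H => ⟪g, A f⟫_ℂ) (h s hs R hR)

/-- The restriction of a compression to a von Neumann algebra which it leaves invariant. -/
noncomputable def restrictCompression (M : VonNeumannAlgebra H)
    (V W : H →L[ℂ] lp (fun _ : ι => H) 2)
    (h : ∀ T ∈ M.toStarSubalgebra, compression V W T ∈ M.toStarSubalgebra) :
    M.toStarSubalgebra →ₗ[ℂ] M.toStarSubalgebra where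
  toFun T := ⟨compression V W T, h T T.2⟩
  map_add' S T := Subtype.ext (map_add (compression V W) (S : H →L[ℂ] H) T)
  map_smul' c T := Subtype.ext (map_smul (compression V W) c (T : H →L[ℂ] H))

/-- If ω comes from (Fₙ), (Gₙ), the composite comes from the doubly indexed families (V Fₙ)ᵢ and (W
Gₙ)ᵢ. -/
theorem InPredual.comp_restrictCompression {M : VonNeumannAlgebra H}
    {ω : M.toStarSubalgebra →ₗ[ℂ] ℂ} (hω : InPredual M ω)
    (V W : H →L[ℂ] lp (fun _ : ι => H) 2)
    (h : ∀ T ∈ M.toStarSubalgebra, compression V W T ∈ M.toStarSubalgebra) :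
    InPredual M (ω ∘ₗ restrictCompression M V W h) := by
  obtain ⟨F, G, hFG⟩ := inPredual_iff_exists_lp.1 hω
  have hmem : ∀ (U : H →L[ℂ] lp (fun _ : ι => H) 2) (E : lp (fun _ : ℕ => H) 2),
      Memℓp (fun p : ℕ × ι => U (E p.1) p.2) 2 := by
    classical
    intro U E
    refine memℓp_two_of_forall_sum_sq_le (C := ‖U‖ ^ 2 * ‖E‖ ^ 2) fun s => ?_
    have hs : s ⊆ s.image Prod.fst ×ˢ s.image Prod.snd := fun p hp =>
      Finset.mem_product.2 ⟨Finset.mem_image_of_mem _ hp, Finset.mem_image_of_mem _ hp⟩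
    refine (Finset.sum_le_sum_of_subset_of_nonneg hs fun p _ _ => sq_nonneg _).trans ?_
    rw [Finset.sum_product]
    refine le_trans ?_ (mul_le_mul_of_nonneg_left (sum_sq_le_norm_sq E (s.image Prod.fst))
      (sq_nonneg _))
    rw [Finset.mul_sum]
    refine Finset.sum_le_sum fun n _ => (sum_sq_le_norm_sq (U (E n)) _).trans ?_
    rw [← mul_pow]
    exact pow_le_pow_left₀ (norm_nonneg _) (U.le_opNorm _) 2
  refine inPredual_of_lp ⟨_, hmem V F⟩ ⟨_, hmem W G⟩ fun T => ?_
  rw [LinearMap.comp_apply, hFG]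
  have h1 := hasSum_inner_ampl (T : H →L[ℂ] H)
    (⟨_, hmem W G⟩ : lp (fun _ : ℕ × ι => H) 2) ⟨_, hmem V F⟩
  refine (hasSum_inner_ampl _ G F).unique ?_
  refine h1.prod_fiberwise fun n => ?_
  have h2 := hasSum_inner_ampl (T : H →L[ℂ] H) (W (G n)) (V (F n))
  rw [← inner_compression] at h2
  exact h2

theorem cbNorm_restrictCompression_le (M : VonNeumannAlgebra H)
    (V W : H →L[ℂ] lp (fun _ : ι => H) 2)
    (h : ∀ T ∈ M.toStarSubalgebra, compression V W T ∈ M.toStarSubalgebra) :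
    cbNorm M (restrictCompression M V W h) ≤ ENNReal.ofReal (‖W‖ * ‖V‖) := by
  refine iSup_le fun n => iSup_le fun a => iSup_le fun ha => ?_
  rw [← ofReal_norm]
  refine ENNReal.ofReal_le_ofReal ?_
  refine (norm_matrixOperator_compression_le V W
    (a.map fun T => (T : H →L[ℂ] H))).trans ?_
  refine mul_le_mul_of_nonneg_right ?_ V.opNorm_nonneg
  exact mul_le_of_le_one_right W.opNorm_nonneg ha

end NormalMaps

/-! ### Multiplication operators on L² and compactly supported functions -/

section Multiplication

variable {X : Type*} [MeasurableSpace X] {μ : Measure X} {ι : Type*}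

theorem norm_sq_eq_integral (f : Lp ℂ 2 μ) : ‖f‖ ^ 2 = ∫ y, ‖f y‖ ^ 2 ∂μ := by
  have h1 := inner_self_eq_norm_sq_to_K (𝕜 := ℂ) f
  rw [L2.inner_def] at h1
  simp only [inner_self_eq_norm_sq_to_K] at h1
  have h2 : ∫ a, ((‖f a‖ : ℂ)) ^ 2 ∂μ = ((∫ y, ‖f y‖ ^ 2 ∂μ : ℝ) : ℂ) := by
    simp only [← Complex.ofReal_pow]
    exact integral_complex_ofReal
  refine Complex.ofReal_injective ?_
  rw [← h2, Complex.ofReal_pow]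
  exact h1.symm

theorem integrable_norm_sq (f : Lp ℂ 2 μ) : Integrable (fun y => ‖f y‖ ^ 2) μ := by
  simpa using (Lp.memLp f).integrable_norm_pow (by simp)

/-- The operator of multiplication by an essentially bounded function on `L²`. -/
noncomputable def mulOp {m : X → ℂ} (hm : MemLp m ∞ μ) : Lp ℂ 2 μ →L[ℂ] Lp ℂ 2 μ :=
  (ContinuousLinearMap.mul ℂ ℂ).holderL μ ∞ 2 2 hm.toLp

theorem coeFn_mulOp {m : X → ℂ} (hm : MemLp m ∞ μ) (f : Lp ℂ 2 μ) :
    mulOp hm f =ᵐ[μ] fun y => m y * f y := by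
  filter_upwards [(ContinuousLinearMap.mul ℂ ℂ).coeFn_holder (r := 2) hm.toLp f, hm.coeFn_toLp]
    with y h1 h2
  rw [← h2]
  exact h1

/-- The operator `f ↦ (mᵢ f)ᵢ` of multiplication by a square-summable family of functions. -/
noncomputable def mulColumn {m : ι → X → ℂ} (hm : ∀ i, MemLp (m i) ∞ μ) {C : ℝ} (hC : 0 ≤ C)
    (h : ∀ (s : Finset ι) (y : X), ∑ i ∈ s, ‖m i y‖ ^ 2 ≤ C ^ 2) :
    Lp ℂ 2 μ →L[ℂ] lp (fun _ : ι => Lp ℂ 2 μ) 2 :=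
  column (fun i => mulOp (hm i)) C hC fun s f => by
    have h1 : ∀ i, ‖mulOp (hm i) f‖ ^ 2 = ∫ y, ‖m i y‖ ^ 2 * ‖f y‖ ^ 2 ∂μ := fun i => by
      rw [norm_sq_eq_integral]
      refine integral_congr_ae ?_
      filter_upwards [coeFn_mulOp (hm i) f] with y hy
      rw [hy, norm_mul, mul_pow]
    have h2 : ∀ i, Integrable (fun y => ‖m i y‖ ^ 2 * ‖f y‖ ^ 2) μ := fun i => by
      refine (integrable_norm_sq (mulOp (hm i) f)).congr ?_
      filter_upwards [coeFn_mulOp (hm i) f] with y hy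
      rw [hy, norm_mul, mul_pow]
    simp only [h1]
    rw [← integral_finsetSum _ fun i _ => h2 i, mul_pow, norm_sq_eq_integral, ← integral_const_mul]
    refine integral_mono (integrable_finsetSum _ fun i _ => h2 i)
      ((integrable_norm_sq f).const_mul _) fun y => ?_
    simp only [← Finset.sum_mul]
    exact mul_le_mul_of_nonneg_right (h s y) (sq_nonneg _)

@[simp]
theorem mulColumn_apply {m : ι → X → ℂ} (hm : ∀ i, MemLp (m i) ∞ μ) {C : ℝ} (hC : 0 ≤ C)
    (h : ∀ (s : Finset ι) (y : X), ∑ i ∈ s, ‖m i y‖ ^ 2 ≤ C ^ 2) (f : Lp ℂ 2 μ) (i : ι) :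
    mulColumn hm hC h f i = mulOp (hm i) f := rfl

theorem integral_norm_inner_le (f g : Lp ℂ 2 μ) :
    ∫ y, ‖⟪f y, g y⟫_ℂ‖ ∂μ ≤ (‖f‖ ^ 2 + ‖g‖ ^ 2) / 2 := by
  rw [norm_sq_eq_integral, norm_sq_eq_integral, ← integral_add (integrable_norm_sq f)
    (integrable_norm_sq g), ← integral_div]
  refine integral_mono (L2.integrable_inner f g).norm
    (((integrable_norm_sq f).add (integrable_norm_sq g)).div_const _) fun y => ?_
  have := norm_inner_le_norm (𝕜 := ℂ) (f y) (g y)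
  change _ ≤ (‖f y‖ ^ 2 + ‖g y‖ ^ 2) / 2
  nlinarith [sq_nonneg (‖f y‖ - ‖g y‖)]

theorem exists_compactlySupported_eLpNorm_sub_le {X : Type*} [TopologicalSpace X] [R1Space X]
    [MeasurableSpace X] [BorelSpace X] (μ : Measure X) [μ.Regular]
    {f : X → ℂ} (hf : MemLp f 2 μ) {ε : ℝ≥0∞} (hε : ε ≠ 0) :
    ∃ g : X → ℂ, eLpNorm (f - g) 2 μ ≤ ε ∧ MemLp g 2 μ ∧
      ∃ K : Set X, IsCompact K ∧ ∀ y ∉ K, g y = 0 := by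
  refine hf.induction_dense (by simp)
    (fun g => MemLp g 2 μ ∧ ∃ K : Set X, IsCompact K ∧ ∀ y ∉ K, g y = 0) ?_ ?_
    (fun g hg => hg.1.aestronglyMeasurable) hε
  · intro c t ht htμ δ hδ
    obtain ⟨η, ηpos, hη⟩ := exists_eLpNorm_indicator_le (μ := μ) (p := 2) (by simp) c hδ
    obtain ⟨s, st, hs, hsc, μs⟩ := ht.exists_isCompact_isClosed_sdiff_lt htμ.ne
      (ENNReal.coe_pos.2 ηpos).ne'
    refine ⟨s.indicator fun _ => c, ?_, memLp_indicator_const 2 hsc.measurableSet c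
      (Or.inr ((measure_mono st).trans_lt htμ).ne), s, hs,
      fun y hy => Set.indicator_of_notMem hy _⟩
    rw [← eLpNorm_neg, neg_sub, ← Set.indicator_sdiff st]
    exact hη _ μs.le
  · rintro g h ⟨hg, K, hK, hgK⟩ ⟨hh, L, hL, hhL⟩
    refine ⟨hg.add hh, K ∪ L, hK.union hL, fun y hy => ?_⟩
    rw [Set.mem_union, not_or] at hy
    simp [hgK y hy.1, hhL y hy.2]

theorem dense_compactlySupported {X : Type*} [TopologicalSpace X] [R1Space X]
    [MeasurableSpace X] [BorelSpace X] (μ : Measure X) [μ.Regular] :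
    Dense {f : Lp ℂ 2 μ | ∃ K : Set X, IsCompact K ∧ ∀ᵐ y ∂μ, y ∉ K → f y = 0} := by
  intro f
  rw [Metric.mem_closure_iff]
  intro ε hε
  obtain ⟨g, hfg, hgm, K, hK, hgK⟩ := exists_compactlySupported_eLpNorm_sub_le μ (Lp.memLp f)
    (ε := ENNReal.ofReal (ε / 2)) (by simpa using hε)
  refine ⟨hgm.toLp, ⟨K, hK, ?_⟩, ?_⟩
  · filter_upwards [hgm.coeFn_toLp] with y hy hyK
    rw [hy, hgK y hyK]
  · rw [dist_eq_norm, Lp.norm_def]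
    have h1 : eLpNorm (f - hgm.toLp : Lp ℂ 2 μ) 2 μ ≤ ENNReal.ofReal (ε / 2) := by
      refine le_trans (le_of_eq (eLpNorm_congr_ae ?_)) hfg
      filter_upwards [Lp.coeFn_sub f hgm.toLp, hgm.coeFn_toLp] with y hy hy'
      rw [hy, Pi.sub_apply, hy', Pi.sub_apply]
    refine (ENNReal.toReal_mono ENNReal.ofReal_ne_top h1).trans_lt ?_
    rw [ENNReal.toReal_ofReal (by positivity)]
    linarith

end Multiplication

/-! ### The regular representation and sufficiency of good coordinates -/

section Regular

variable {G : Type*} [Group G] [TopologicalSpace G] [IsTopologicalGroup G]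
  [MeasurableSpace G] [BorelSpace G] (μ : Measure G) [μ.IsHaarMeasure]

theorem coeFn_leftRegular (x : G) (f : Lp ℂ 2 μ) :
    leftRegular μ x f =ᵐ[μ] fun y => f (x⁻¹ * y) :=
  Lp.coeFn_compMeasurePreserving f (measurePreserving_mul_left μ x⁻¹)

theorem leftRegular_one : leftRegular μ (1 : G) = 1 := by
  ext1 f
  refine Lp.ext ?_
  filter_upwards [coeFn_leftRegular μ 1 f] with y hy
  rw [hy]
  simp

theorem leftRegular_mul (x y : G) : leftRegular μ (x * y) = leftRegular μ x * leftRegular μ y := by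
  ext1 f
  refine Lp.ext ?_
  filter_upwards [coeFn_leftRegular μ (x * y) f, coeFn_leftRegular μ x (leftRegular μ y f),
    (measurePreserving_mul_left μ x⁻¹).quasiMeasurePreserving.ae (coeFn_leftRegular μ y f)]
    with z h1 h2 h3
  rw [h1, mul_apply_eq_comp, h2, h3, mul_inv_rev, mul_assoc]

theorem norm_leftRegular_apply (x : G) (f : Lp ℂ 2 μ) : ‖leftRegular μ x f‖ = ‖f‖ :=
  LinearIsometry.norm_map _ f

theorem star_leftRegular (x : G) : star (leftRegular μ x) = leftRegular μ x⁻¹ := by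
  rw [ContinuousLinearMap.star_eq_adjoint]
  symm
  rw [ContinuousLinearMap.eq_adjoint_iff]
  intro f g
  have h1 : f = leftRegular μ x (leftRegular μ x⁻¹ f) := by
    rw [← mul_apply_eq_comp, ← leftRegular_mul, mul_inv_cancel, leftRegular_one]; rfl
  conv_rhs => rw [h1]
  let U : Lp ℂ 2 μ →ₗᵢ[ℂ] Lp ℂ 2 μ :=
    ⟨(leftRegular μ x).toLinearMap, norm_leftRegular_apply μ x⟩
  exact (U.inner_map_map _ _).symm

theorem one_mem_range_leftRegular : 1 ∈ Set.range (leftRegular μ) := ⟨1, leftRegular_one μ⟩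

theorem mul_mem_range_leftRegular : ∀ s ∈ Set.range (leftRegular μ),
    ∀ t ∈ Set.range (leftRegular μ), s * t ∈ Set.range (leftRegular μ) := by
  rintro _ ⟨x, rfl⟩ _ ⟨y, rfl⟩
  exact ⟨x * y, leftRegular_mul μ x y⟩

theorem star_mem_range_leftRegular : ∀ s ∈ Set.range (leftRegular μ),
    star s ∈ Set.range (leftRegular μ) := by
  rintro _ ⟨x, rfl⟩
  exact ⟨x⁻¹, (star_leftRegular μ x).symm⟩

variable {μ} in
-- λ(G) is a self-adjoint monoid with bicommutant 𝔐(G). Thus any functional representing φψ must be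
-- the composite of ω with a normal Φ multiplying each λ(x) by φ(x).
theorem Represents.unique {ω ω' : (groupVN μ).toStarSubalgebra →ₗ[ℂ] ℂ} {ψ : G → ℂ}
    (h : Represents μ ω ψ) (h' : Represents μ ω' ψ) : ω = ω' := by
  refine InPredual.eq_of_eqOn (one_mem_range_leftRegular μ) (mul_mem_range_leftRegular μ)
    (star_mem_range_leftRegular μ) h.1 h'.1 ?_
  rintro _ ⟨x, rfl⟩
  exact (h.2 x).symm.trans (h'.2 x)

/-- If `∑ᵢ conj (nᵢ(y)) mᵢ(x⁻¹ y) = φ(x)`, then `∑ᵢ nᵢ* λ(x) mᵢ = φ(x) λ(x)`. -/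
theorem compression_leftRegular [μ.Regular] {ι : Type*} {φ : G → ℂ}
    {m n : ι → G → ℂ} (hm : ∀ i, MemLp (m i) ∞ μ) (hn : ∀ i, MemLp (n i) ∞ μ) {C D : ℝ}
    (hC : 0 ≤ C) (hD : 0 ≤ D)
    (hmC : ∀ (s : Finset ι) (y : G), ∑ i ∈ s, ‖m i y‖ ^ 2 ≤ C ^ 2)
    (hnD : ∀ (s : Finset ι) (y : G), ∑ i ∈ s, ‖n i y‖ ^ 2 ≤ D ^ 2)
    (hcount : ∀ K : Set G, IsCompact K → {i | ∃ y ∈ K, m i y ≠ 0}.Countable)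
    (hφ : ∀ x y, HasSum (fun i => conj (n i y) * m i (x⁻¹ * y)) (φ x)) (x : G) :
    compression (mulColumn hm hC hmC) (mulColumn hn hD hnD) (leftRegular μ x) =
      φ x • leftRegular μ x := by
  set V := mulColumn (μ := μ) hm hC hmC with hV
  set W := mulColumn (μ := μ) hn hD hnD with hW
  refine ContinuousLinearMap.ext fun f => congrFun (Continuous.ext_on (dense_compactlySupported μ)
    (compression V W (leftRegular μ x)).continuous (φ x • leftRegular μ x).continuous ?_) f
  rintro f ⟨K, hK, hf⟩
  refine ext_inner_left ℂ fun g => ?_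
  -- On functions supported in `K` only countably many mᵢ act nontrivially. Over these indices the
  -- almost everywhere identities hold simultaneously, and sum and integral may be exchanged.
  have hc := hcount K hK
  set s := {i | ∃ y ∈ K, m i y ≠ 0} with hs
  have : Countable s := hc.to_subtype
  have h1 := hasSum_inner_ampl (leftRegular μ x) (W g) (V f)
  rw [← inner_compression] at h1
  have hzero : ∀ i ∉ s, V f i = 0 := by
    intro i hi
    refine Lp.ext ?_
    filter_upwards [coeFn_mulOp (hm i) f, hf, Lp.coeFn_zero ℂ 2 μ] with y h2 h3 h4
    rw [hV, mulColumn_apply, h2, h4]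
    by_cases hy : y ∈ K
    · have : m i y = 0 := by
        by_contra h
        exact hi ⟨y, hy, h⟩
      simp [this]
    · simp [h3 hy]
  rw [← hasSum_subtype_iff_of_support_subset (s := s)] at h1
  swap
  · intro i hi
    by_contra h
    simp [hzero i h] at hi
  refine h1.unique ?_
  let F : s → G → ℂ := fun i y => ⟪(W g i : Lp ℂ 2 μ) y, (leftRegular μ x (V f i)) y⟫_ℂ
  have hF := hasSum_integral_of_summable_integral_norm (μ := μ) (F := F)
    (fun i => L2.integrable_inner _ _) (by
      refine Summable.of_nonneg_of_le (fun i => integral_nonneg fun y => norm_nonneg _)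
        (fun i => integral_norm_inner_le _ _) (Summable.div_const ?_ 2)
      simp only [norm_leftRegular_apply]
      exact ((memℓp_two_iff_summable_sq.1 (W g).2).subtype s).add
        ((memℓp_two_iff_summable_sq.1 (V f).2).subtype s))
  have heq : ⟪g, (φ x • leftRegular μ x) f⟫_ℂ = ∫ y, ∑' i : s, F i y ∂μ := ?_
  · rw [heq]
    exact hF
  rw [smul_apply, inner_smul_right, L2.inner_def, ← integral_const_mul]
  refine integral_congr_ae ?_
  have hW' : ∀ᵐ y ∂μ, ∀ i : s, (W g i : Lp ℂ 2 μ) y = n i y * g y :=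
    ae_all_iff.2 fun i => coeFn_mulOp (hn i) g
  have hV' : ∀ᵐ y ∂μ, ∀ i : s, (V f i : Lp ℂ 2 μ) y = m i y * f y :=
    ae_all_iff.2 fun i => coeFn_mulOp (hm i) f
  have hV'' : ∀ᵐ y ∂μ, ∀ i : s, (leftRegular μ x (V f i)) y = (V f i : Lp ℂ 2 μ) (x⁻¹ * y) :=
    ae_all_iff.2 fun i => coeFn_leftRegular μ x _
  have hq := (measurePreserving_mul_left μ x⁻¹).quasiMeasurePreserving
  filter_upwards [hW', hq.ae hV', hV'', hq.ae hf, coeFn_leftRegular μ x f] with y h2 h3 h4 h5 h6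
  have h7 : ∀ i : s, F i y = conj (g y) * f (x⁻¹ * y) * (conj (n i y) * m i (x⁻¹ * y)) := by
    intro i
    simp only [F, h2, h3, h4, RCLike.inner_apply, map_mul]
    ring
  simp only [h7]
  rw [h6, RCLike.inner_apply]
  by_cases hy : x⁻¹ * y ∈ K
  · have h8 := hφ x y
    rw [← hasSum_subtype_iff_of_support_subset (s := s)] at h8
    · refine Eq.trans ?_ (h8.mul_left (conj (g y) * f (x⁻¹ * y))).tsum_eq.symm
      ring
    · intro i hi
      exact ⟨_, hy, right_ne_zero_of_mul hi⟩
  · simp [h5 hy]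

/-- The sufficiency criterion for completely bounded multipliers. -/
theorem isCBMultiplier_of_compression {ι : Type*} {φ : G → ℂ} (hφ : Continuous φ)
    (V W : Lp ℂ 2 μ →L[ℂ] lp (fun _ : ι => Lp ℂ 2 μ) 2)
    (h : ∀ x, compression V W (leftRegular μ x) = φ x • leftRegular μ x) :
    IsCBMultiplier μ φ ∧ cbMultiplierNorm μ φ ≤ ENNReal.ofReal (‖W‖ * ‖V‖) := by
  have hmem : ∀ T ∈ (groupVN μ).toStarSubalgebra,
      compression V W T ∈ (groupVN μ).toStarSubalgebra := fun T hT =>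
    compression_mem (one_mem_range_leftRegular μ) (mul_mem_range_leftRegular μ)
      (star_mem_range_leftRegular μ) V W (by
        rintro _ ⟨x, rfl⟩
        rw [h]
        exact SMulMemClass.smul_mem _ (mem_generatedVonNeumannAlgebra ⟨x, rfl⟩)) hT
  set Φ := restrictCompression (groupVN μ) V W hmem with hΦ
  have hΦx : ∀ x, Φ (leftRegularVN μ x) = φ x • leftRegularVN μ x := fun x => Subtype.ext (h x)
  have hrep : ∀ ω ψ, Represents μ ω ψ → Represents μ (ω ∘ₗ Φ) (φ * ψ) := fun ω ψ hω =>
    ⟨hω.1.comp_restrictCompression V W hmem, fun x => by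
      rw [LinearMap.comp_apply, hΦx, map_smul, ← hω.2, smul_eq_mul, Pi.mul_apply]⟩
  have htr : IsTranspose μ φ Φ := fun ψ ω ω' hω hω' T =>
    DFunLike.congr_fun ((hrep ω ψ hω).unique hω') T
  have hcb := cbNorm_restrictCompression_le (groupVN μ) V W hmem
  refine ⟨⟨⟨hφ, ?_⟩, Φ, htr, hcb.trans_lt ENNReal.ofReal_lt_top⟩, (iInf₂_le Φ htr).trans hcb⟩
  rintro ψ ⟨ω, hω⟩
  exact ⟨_, hrep ω ψ hω⟩

theorem IsGilbertPair.isCBMultiplier [μ.Regular] {H : Type*}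
    [NormedAddCommGroup H] [InnerProductSpace ℂ H] {ι : Type*} (e : HilbertBasis ι ℂ H) {φ : G → ℂ}
    (hφ : Continuous φ) {k : ℝ} {ξ η : G → H} (h : IsGilbertPair φ k ξ η)
    (hξ : HasGoodCoordinates e ξ) (hη : HasGoodCoordinates e η) :
    IsCBMultiplier μ φ ∧ cbMultiplierNorm μ φ ≤ ENNReal.ofReal k := by
  -- The inverse makes ∑ conj(nᵢ(y)) mᵢ(x⁻¹y) = ⟨ξ(y⁻¹x), η(y⁻¹)⟩ = φ(x) independent of `y`.
  let m : ι → G → ℂ := fun i y => ⟪e i, ξ y⁻¹⟫_ℂ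
  let n : ι → G → ℂ := fun i y => ⟪e i, η y⁻¹⟫_ℂ
  have hb : ∀ {ζ : G → H} {C : ℝ}, (∀ y, ‖ζ y‖ ≤ C) → ∀ (s : Finset ι) (y : G),
      ∑ i ∈ s, ‖⟪e i, ζ y⁻¹⟫_ℂ‖ ^ 2 ≤ C ^ 2 := fun {ζ C} hζ s y =>
    (e.orthonormal.sum_inner_products_le (ζ y⁻¹)).trans
      (pow_le_pow_left₀ (norm_nonneg _) (hζ _) 2)
  have hL : ∀ {ζ : G → H} {C : ℝ}, (∀ y, ‖ζ y‖ ≤ C) → ∀ i, (Continuous fun y => ⟪e i, ζ y⟫_ℂ) →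
      MemLp (fun y => ⟪e i, ζ y⁻¹⟫_ℂ) ∞ μ := fun {ζ C} hζ i hc =>
    memLp_top_of_bound (hc.comp continuous_inv).aestronglyMeasurable C (.of_forall fun y =>
      (norm_inner_le_norm _ _).trans (by rw [e.orthonormal.1 i, one_mul]; exact hζ _))
  have hC : 0 ≤ ⨆ x, ‖ξ x‖ := Real.iSup_nonneg fun _ => norm_nonneg _
  have hD : 0 ≤ ⨆ x, ‖η x‖ := Real.iSup_nonneg fun _ => norm_nonneg _
  have hcount : ∀ K : Set G, IsCompact K → {i | ∃ y ∈ K, m i y ≠ 0}.Countable := by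
    intro K hK
    -- Compactness passes from local countability to countability on the whole of K⁻¹.
    refine hK.inv.induction_on (p := fun K => {i | ∃ y ∈ K, ⟪e i, ξ y⟫_ℂ ≠ 0}.Countable) ?_ ?_ ?_ ?_
      |>.mono ?_
    · simp
    · refine fun s t hst ht => ht.mono ?_
      rintro i ⟨y, hy, hne⟩
      exact ⟨y, hst hy, hne⟩
    · refine fun s t hs ht => (hs.union ht).mono ?_
      rintro i ⟨y, hy | hy, hne⟩
      · exact Or.inl ⟨y, hy, hne⟩
      · exact Or.inr ⟨y, hy, hne⟩
    · intro x _
      obtain ⟨U, hU, hUc⟩ := hξ.2 x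
      exact ⟨U, mem_nhdsWithin_of_mem_nhds hU, hUc⟩
    · rintro i ⟨y, hy, hne⟩
      exact ⟨y⁻¹, Set.inv_mem_inv.2 hy, hne⟩
  obtain ⟨h1, h2⟩ := isCBMultiplier_of_compression μ hφ _ _ (compression_leftRegular μ
    (m := m) (n := n) (fun i => hL h.norm_le_left i (hξ.1 i))
    (fun i => hL h.norm_le_right i (hη.1 i)) hC hD (hb h.norm_le_left) (hb h.norm_le_right)
    hcount (fun x y => by
      have := e.hasSum_inner_mul_inner (η y⁻¹) (ξ (x⁻¹ * y)⁻¹)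
      rw [← h.2.2.1] at this
      simpa [m, n, inner_conj_symm] using this))
  refine ⟨h1, h2.trans (ENNReal.ofReal_le_ofReal (le_trans ?_ h.2.2.2))⟩
  rw [mul_comm]
  exact mul_le_mul (norm_column_le _ _ _ _) (norm_column_le _ _ _ _)
    (ContinuousLinearMap.opNorm_nonneg _) hC

end Regular

/-! ### Norms of scalar matrices twisted by unitaries -/

section ScalarMatrices

variable {H : Type*} [NormedAddCommGroup H] [InnerProductSpace ℂ H] {n : ℕ}

theorem norm_toEuclideanCLM_transpose (c : Matrix (Fin n) (Fin n) ℂ) :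
    ‖Matrix.toEuclideanCLM (𝕜 := ℂ) c.transpose‖ = ‖Matrix.toEuclideanCLM (𝕜 := ℂ) c‖ := by
  have h : ∀ c : Matrix (Fin n) (Fin n) ℂ, ‖Matrix.toEuclideanCLM (𝕜 := ℂ) c.transpose‖ ≤
      ‖Matrix.toEuclideanCLM (𝕜 := ℂ) c‖ := by
    intro c
    rw [norm_toEuclideanCLM_le_iff _ (norm_nonneg _)]
    intro u v
    have h1 := (norm_toEuclideanCLM_le_iff c (norm_nonneg _)).1 le_rfl v u
    rw [Finset.sum_comm, mul_comm (√_)] at h1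
    simpa only [Matrix.transpose_apply, mul_right_comm] using h1
  exact le_antisymm (h c) (by simpa using h c.transpose)

/-- An orthonormal basis identifies `H` with a Hilbert sum of copies of `ℂ`, so c ⊗ 1 is a
compression of the matrix `c` itself. -/
theorem norm_matrixOperator_smul_one_le [CompleteSpace H] (c : Matrix (Fin n) (Fin n) ℂ) :
    ‖matrixOperator (Matrix.of fun i j => c i j • (1 : H →L[ℂ] H))‖ ≤
      ‖Matrix.toEuclideanCLM (𝕜 := ℂ) c‖ := by
  obtain ⟨w, b, -⟩ := exists_hilbertBasis ℂ H
  let V : H →L[ℂ] lp (fun _ : w => ℂ) 2 := b.repr.toLinearIsometry.toContinuousLinearMap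
  have hV : ‖V‖ ≤ 1 := LinearIsometry.norm_toContinuousLinearMap_le _
  have h1 := norm_matrixOperator_compression_le V V (Matrix.of fun i j => c i j • (1 : ℂ →L[ℂ] ℂ))
  have h2 : (Matrix.of fun i j => c i j • (1 : ℂ →L[ℂ] ℂ)).map (compression V V) =
      Matrix.of fun i j => c i j • (1 : H →L[ℂ] H) := by
    ext1 i j
    refine ContinuousLinearMap.ext fun f => ext_inner_left ℂ fun g => ?_
    have h3 : ampl w (c i j • (1 : ℂ →L[ℂ] ℂ)) (V f) = c i j • V f := lp.ext rfl
    rw [Matrix.map_apply, Matrix.of_apply, Matrix.of_apply, inner_compression, h3,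
      inner_smul_right, smul_apply, inner_smul_right]
    exact congrArg _ (b.repr.inner_map_map g f)
  have h4 : matrixOperator (Matrix.of fun i j => c i j • (1 : ℂ →L[ℂ] ℂ)) =
      Matrix.toEuclideanCLM (𝕜 := ℂ) c := by
    ext v i
    rw [matrixOperator_apply]
    rfl
  rw [h2, h4] at h1
  refine h1.trans ?_
  calc ‖V‖ * ‖Matrix.toEuclideanCLM (𝕜 := ℂ) c‖ * ‖V‖
      ≤ 1 * ‖Matrix.toEuclideanCLM (𝕜 := ℂ) c‖ * 1 := by gcongr
    _ = _ := by ring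

/-- The matrix is diag(V)(c ⊗ 1)diag(U), with each `U i` unitary and inverse to `V i`. The vectors
(zⱼ Vⱼ h) with a fixed nonzero `h` give the lower bound. -/
theorem norm_matrixOperator_smul_mul [CompleteSpace H] [Nontrivial H]
    (c : Matrix (Fin n) (Fin n) ℂ) (U V : Fin n → H →L[ℂ] H) (hU : ∀ i v, ‖U i v‖ = ‖v‖)
    (hV : ∀ i v, ‖V i v‖ = ‖v‖) (hUV : ∀ i v, U i (V i v) = v) :
    ‖matrixOperator (Matrix.of fun i j => c i j • (V i * U j))‖ =
      ‖Matrix.toEuclideanCLM (𝕜 := ℂ) c‖ := by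
  refine le_antisymm ?_ ?_
  · refine ContinuousLinearMap.opNorm_le_bound _ (norm_nonneg _) fun v => ?_
    have h1 := (matrixOperator (Matrix.of fun i j => c i j • (1 : H →L[ℂ] H))).le_of_opNorm_le
      (norm_matrixOperator_smul_one_le c) (WithLp.toLp 2 fun j => U j (v j))
    refine le_trans (le_of_eq ?_) (h1.trans (le_of_eq ?_))
    · rw [PiLp.norm_eq_of_L2, PiLp.norm_eq_of_L2]
      congr 1
      refine Finset.sum_congr rfl fun i _ => ?_
      rw [matrixOperator_apply, matrixOperator_apply]
      conv_rhs => rw [← hV i]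
      simp [map_sum]
    · congr 1
      rw [PiLp.norm_eq_of_L2, PiLp.norm_eq_of_L2]
      simp [hU]
  · obtain ⟨h, hh⟩ := exists_ne (0 : H)
    have hpos : 0 < ‖h‖ := norm_pos_iff.2 hh
    have hz : ∀ (W : Fin n → H →L[ℂ] H) (_ : ∀ i v, ‖W i v‖ = ‖v‖) (z : EuclideanSpace ℂ (Fin n))
        (v : PiLp 2 fun _ : Fin n => H), (∀ i, v i = W i (z i • h)) → ‖v‖ = ‖z‖ * ‖h‖ := by
      intro W hW z v hv
      rw [PiLp.norm_eq_of_L2, EuclideanSpace.norm_eq, ← Real.sqrt_sq hpos.le,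
        ← Real.sqrt_mul (by positivity), Finset.sum_mul]
      congr 1
      refine Finset.sum_congr rfl fun i _ => ?_
      rw [hv, hW, norm_smul, mul_pow]
    refine ContinuousLinearMap.opNorm_le_bound _ (norm_nonneg _) fun z => ?_
    set A := matrixOperator (Matrix.of fun i j => c i j • (V i * U j)) with hA
    have h1 := A.le_opNorm (WithLp.toLp 2 fun j => V j (z j • h))
    rw [hz V hV z (WithLp.toLp 2 fun j => V j (z j • h)) fun i => rfl, hz V hV (Matrix.toEuclideanCLM (𝕜 := ℂ) c z) _ fun i => ?_,
      ← mul_assoc] at h1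
    · exact le_of_mul_le_mul_right h1 hpos
    · rw [hA, matrixOperator_apply]
      have h2 : Matrix.toEuclideanCLM (𝕜 := ℂ) c z i = ∑ j, c i j * z j := rfl
      rw [h2, Finset.sum_smul, map_sum]
      refine Finset.sum_congr rfl fun j _ => ?_
      simp [hUV, smul_smul, mul_comm]

end ScalarMatrices

/-! ### Completely bounded multipliers satisfy the Schur bound -/

section Necessity

variable {G : Type*} [Group G] [TopologicalSpace G] [IsTopologicalGroup G]
  [MeasurableSpace G] [BorelSpace G] {μ : Measure G} [μ.IsHaarMeasure]

/-- Vector functionals T ↦ ⟨Tf, g⟩ lie in the predual and separate operators; duality with their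
coefficient functions determines Φ on λ(x). -/
theorem IsTranspose.apply_leftRegularVN {φ : G → ℂ} (hφ : IsMultiplier μ φ)
    {Φ : (groupVN μ).toStarSubalgebra →ₗ[ℂ] (groupVN μ).toStarSubalgebra}
    (hΦ : IsTranspose μ φ Φ) (x : G) : Φ (leftRegularVN μ x) = φ x • leftRegularVN μ x := by
  refine Subtype.ext (ContinuousLinearMap.ext fun f => ext_inner_left ℂ fun g => ?_)
  let ω : (groupVN μ).toStarSubalgebra →ₗ[ℂ] ℂ :=
    { toFun := fun T => ⟪g, (T : Lp ℂ 2 μ →L[ℂ] Lp ℂ 2 μ) f⟫_ℂ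
      map_add' := fun S T => by simp [inner_add_right]
      map_smul' := fun c T => by simp [inner_smul_right] }
  have hω : InPredual (groupVN μ) ω := by
    refine inPredual_of_lp (lp.single 2 (0 : ℕ) f) (lp.single 2 (0 : ℕ) g) fun T => ?_
    rw [ampl_single, lp.inner_single_left, lp.single_apply_self]
    rfl
  have hrep : Represents μ ω fun x => ω (leftRegularVN μ x) := ⟨hω, fun _ => rfl⟩
  obtain ⟨ω', hω'⟩ := hφ.2 _ ⟨ω, hrep⟩
  have h1 := hΦ _ ω ω' hrep hω' (leftRegularVN μ x)
  rw [← hω'.2] at h1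
  refine h1.trans ?_
  exact (map_smul ω (φ x) (leftRegularVN μ x)).symm

instance nontrivial_L2 [LocallyCompactSpace G] : Nontrivial (Lp ℂ 2 μ) := by
  obtain ⟨U, hU, hUo, hμU⟩ := μ.exists_isOpen_measure_lt_top (1 : G)
  refine ⟨indicatorConstLp 2 hUo.measurableSet hμU.ne 1, 0, fun h => ?_⟩
  have h1 := congrArg norm h
  rw [norm_indicatorConstLp (by simp) (by simp), norm_zero, norm_one, one_mul] at h1
  have h2 : 0 < μ.real U :=
    ENNReal.toReal_pos (hUo.measure_pos μ ⟨1, hU⟩).ne' hμU.ne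
  exact (Real.rpow_pos_of_pos h2 _).ne' h1

theorem schurNorm_le_cbNorm [LocallyCompactSpace G] {φ : G → ℂ}
    {Φ : (groupVN μ).toStarSubalgebra →ₗ[ℂ] (groupVN μ).toStarSubalgebra}
    (hΦ : ∀ x, Φ (leftRegularVN μ x) = φ x • leftRegularVN μ x) {n : ℕ} (x : Fin n → G) :
    schurNorm (Matrix.of fun i j => φ ((x j)⁻¹ * x i)) ≤ cbNorm (groupVN μ) Φ := by
  refine iSup₂_le fun b hb => ?_
  have hnorm : ∀ c : Matrix (Fin n) (Fin n) ℂ,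
      ‖matrixOperator (Matrix.of fun i j => c i j • leftRegular μ ((x i)⁻¹ * x j))‖ =
        ‖Matrix.toEuclideanCLM (𝕜 := ℂ) c‖ := by
    intro c
    simp only [leftRegular_mul]
    refine norm_matrixOperator_smul_mul c (fun i => leftRegular μ (x i))
      (fun i => leftRegular μ (x i)⁻¹) (fun i => norm_leftRegular_apply μ _)
      (fun i => norm_leftRegular_apply μ _) fun i v => ?_
    rw [← mul_apply_eq_comp, ← leftRegular_mul, mul_inv_cancel, leftRegular_one]
    rfl
  -- Transposing `b` is needed because λ(xᵢ⁻¹xⱼ) acquires the factor φ(xᵢ⁻¹xⱼ), the (j, i) entry of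
  -- the Schur matrix.
  let A : Matrix (Fin n) (Fin n) (groupVN μ).toStarSubalgebra :=
    Matrix.of fun i j => b j i • leftRegularVN μ ((x i)⁻¹ * x j)
  have hA : ‖matrixOperator (A.map fun T => (T : Lp ℂ 2 μ →L[ℂ] Lp ℂ 2 μ))‖ ≤ 1 := by
    rw [← norm_toEuclideanCLM_transpose, ← hnorm] at hb
    exact hb
  have hΦA : (A.map fun T => (Φ T : Lp ℂ 2 μ →L[ℂ] Lp ℂ 2 μ)) = Matrix.of fun i j =>
      ((Matrix.of fun i j => φ ((x j)⁻¹ * x i)).hadamard b).transpose i j •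
        leftRegular μ ((x i)⁻¹ * x j) := by
    ext1 i j
    simp only [A, Matrix.map_apply, Matrix.of_apply, map_smul, hΦ, Matrix.transpose_apply,
      Matrix.hadamard_apply, smul_smul, mul_comm (b j i)]
    rfl
  have h1 : ‖Matrix.toEuclideanCLM (𝕜 := ℂ) ((Matrix.of fun i j => φ ((x j)⁻¹ * x i)).hadamard b)‖ₑ
      = ‖matrixOperator (A.map fun T => (Φ T : Lp ℂ 2 μ →L[ℂ] Lp ℂ 2 μ))‖ₑ := by
    rw [← ofReal_norm, ← ofReal_norm, hΦA, hnorm, norm_toEuclideanCLM_transpose]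
  rw [h1]
  exact le_iSup_of_le n (le_iSup₂_of_le A hA le_rfl)

theorem IsCBMultiplier.schurNorm_le [LocallyCompactSpace G] {φ : G → ℂ}
    (hφ : IsCBMultiplier μ φ) {n : ℕ} (x : Fin n → G) :
    schurNorm (Matrix.of fun i j => φ ((x j)⁻¹ * x i)) ≤ cbMultiplierNorm μ φ :=
  le_iInf₂ fun _ hΦ => schurNorm_le_cbNorm (fun y => hΦ.apply_leftRegularVN hφ.1 y) x

end Necessity
end HerzSchur

theorem theorem3p2 {G : Type u} [Group G] [TopologicalSpace G] [IsTopologicalGroup G]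
    [LocallyCompactSpace G] [T2Space G] [MeasurableSpace G] [BorelSpace G]
    (μ : Measure G) [μ.IsHaarMeasure] [μ.Regular]
    (φ : G → ℂ) (hφ : Continuous φ) (k : ℝ) (hk : 0 ≤ k) :
    List.TFAE [
      HerzSchur.IsCBMultiplier μ φ ∧ HerzSchur.cbMultiplierNorm μ φ ≤ ENNReal.ofReal k,
      ∀ (n : ℕ) (x : Fin n → G), Function.Injective x →
        HerzSchur.schurNorm (Matrix.of fun i j => φ ((x j)⁻¹ * x i)) ≤ ENNReal.ofReal k,
      ∃ (H : Type (max u v)) (_ : NormedAddCommGroup H) (_ : InnerProductSpace ℂ H)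
        (_ : CompleteSpace H) (ξ η : G → H), HerzSchur.IsGilbertPair φ k ξ η,
      ∃ (H : Type (max u v)) (_ : NormedAddCommGroup H) (_ : InnerProductSpace ℂ H)
        (_ : CompleteSpace H) (ξ η : G → H), HerzSchur.IsGilbertPair φ k ξ η ∧
          ∀ (ι : Type (max u v)) (e : HilbertBasis ι ℂ H),
            HerzSchur.HasGoodCoordinates e ξ ∧ HerzSchur.HasGoodCoordinates e η] := by
  tfae_have 1 → 2 := fun ⟨h, hle⟩ n x _ => (h.schurNorm_le x).trans hle
  tfae_have 2 → 3 := fun h => HerzSchur.exists_isGilbertPair_of_schurNorm_le.{u, v} hk h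
  tfae_have 3 → 4 := fun ⟨_, _, _, _, _, _, h⟩ => h.exists_hasGoodCoordinates μ hφ
  tfae_have 4 → 1 := by
    rintro ⟨H, _, _, _, ξ, η, h, hgood⟩
    -- A single orthonormal basis with good coordinates suffices here.
    obtain ⟨w, e, -⟩ := exists_hilbertBasis ℂ H
    exact h.isCBMultiplier μ e hφ (hgood w e).1 (hgood w e).2
  tfae_finish
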